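/- **Setup.** Let $V$ be a finite index set and let $(E_v,\mathcal E_v)$, $v\in V$, be standard Borel spaces with distinguished points $o_v\in E_v$. For $A\subseteq V$ put $E_A=\prod_{v\in A}E_v$ with the product $\sigma$-field, $o_A=(o_v)_{v\in A}$, $E_A^o=E_A\setminus\{o_A\}$ with the trace $\sigma$-field, and $y_A=(y_v)_{v\in A}$. For each $v$ let $L_{1,v}\subseteq L_{2,v}\subseteq\cdots$ be measurable sets with $\bigcup_h L_{h,v}=E_v\setminus\{o_v\}$; for nonempty $D\subseteq V$ put $L_{h,D}=\bigcup_{v\in D}\{y\in E_D: y_v\in L_{h,v}\}$, and call a subset of $E_D$ bounded if it is contained in some $L_{h,D}$. Let $\Lambda=\Lambda_V^o$ be a measure on $E_V^o$ that is finite on bounded measurable sets and satisfies the explosiveness condition $$\Lambda(y_A\neq o_A,\ y_B=o_B)\in\{0,\infty\}\qquad\text{for all disjoint } A,B\subseteq V \text{ with } A\neq\emptyset .$$ For $D\subseteq V$ let $\Lambda_D^o$ be the measure $G\mapsto\Lambda(y_D\in G)$ on $E_D^o$. For a measurable bounded $R\subseteq E_V$ with $\Lambda(R)>0$ let $P_R=\Lambda(\,\cdot\cap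 R)/\Lambda(R)$. Put $R_{h,v}=\{y\in E_V: y_v\in L_{h,v}\}$. A Poisson process with mean measure $\Lambda$ is a random s-finite $\{0,1,\dots,\infty\}$-valued measure $\xi$ on $E_V^o$ such that $\xi(G)$ is Poisson with mean $\Lambda(G)$ for each measurable $G$ (a.s. equal to $0$ or $\infty$ if $\Lambda(G)=0$ or $\infty$) and $\xi(G_1),\dots,\xi(G_m)$ are independent for disjoint measurable $G_1,\dots,G_m$. For $I\subseteq V$ put $\xi_I(\cdot)=\xi(y_I\in\cdot)$, a random measure on $E_I$. The $\sigma$-field on a space of measures is the one generated by the evaluations at measurable sets. Throughout, a conditional independence given $Y_C$ or $\xi_C$ with $C=\emptyset$ is understood as unconditional independence, and conditions on $y_C$ are void if $C=\emptyset$. **Theorem.** Let $A,B,C$ be pairwise disjoint subsets of $V$ with $A\ne\emptyset$ and $B\neq\emptyset$. (1) Suppose that $A\cup B\cup C=V$. The following statements are equivalent. * (a) For every $R=\prod_{v\in V}R_v$ with $R_v\in\mathcal E_v$, $R$ bounded and $\Lambda(R)>0$, one has $Y_A\perp Y_B\mid Y_C$ for $Y\sim P_R$. (This is the definition of $A\perp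 B\mid C$ for $\Lambda$.) * (b) For all $v\in V$ and all $h$ with $\Lambda(R_{h,v})>0$, one has $Y_A\perp Y_B\mid Y_C$ for $Y\sim P_{R_{h,v}}$. * (c) For all $c\in C$ and all $h$ with $\Lambda(R_{h,c})>0$, one has $Y_A\perp Y_B\mid Y_C$ for $Y\sim P_{R_{h,c}}$; and $$\Lambda(y_A\neq o_A,\ y_B\neq o_B,\ y_C=o_C)=0.\qquad(*)$$ * (d) Condition $(*)$ holds and, if $C\ne\emptyset$, then for some (equivalently, for every) probability kernel $\kappa$ from $E_C^o$ to $E_A\times E_B$ that disintegrates $\Lambda$ over $\{y_C\neq o_C\}$, i.e. $$\Lambda\big(y_C\neq o_C,\ (y_C,(y_A,y_B))\in G\big)=\int\kappa\big(\{w:(z,w)\in G\}\mid z\big)\,\Lambda_C^o(dz)\quad\text{for all measurable }G\subseteq E_C^o\times(E_A\times E_B),$$ one has $\kappa(\cdot\mid z)=\kappa_A(\cdot\mid z)\otimes\kappa_B(\cdot\mid z)$ for $\Lambda_C^o$-a.e. $z$, where $\kappa_A,\kappa_B$ are the marginal kernels of $\kappa$ on $E_A$ and $E_B$. * (e) $\xi_A\perp\xi_B\mid\xi_C$,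 where $\xi$ is a Poisson process on $E_V^o$ with mean measure $\Lambda$ (any such process on any probability space). (2) If $A\cup B\cup C$ is an arbitrary subset $D$ of $V$, the same equivalences hold when in (a)–(d) the set $V$ is replaced by $D$ and $\Lambda$ by the marginal measure $\Lambda_D^o$ (statement (a) is then the definition of $A\perp B\mid C$ for $\Lambda$), while (e) is left unchanged, with $\xi$ still the Poisson process on $E_V^o$ with mean measure $\Lambda$. -/

import Mathlib

open MeasureTheory ProbabilityTheory
open scoped ENNReal

namespace PuncturedCI

/-! ### Conditional independence of random elements -/

/-- `X ⊥ Y | Z` under `P`, for random elements of arbitrary measurable spaces on an arbitrary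
probability space: `P(X ∈ s, Y ∈ t | Z) = P(X ∈ s | Z) P(Y ∈ t | Z)` almost surely. -/
def CondIndepGiven {Ω α β γ : Type*} [MeasurableSpace Ω] [MeasurableSpace α] [MeasurableSpace β]
    [mγ : MeasurableSpace γ] (X : Ω → α) (Y : Ω → β) (Z : Ω → γ) (P : Measure Ω) : Prop :=
  ∀ s t, MeasurableSet s → MeasurableSet t →
    P⟦X ⁻¹' s ∩ Y ⁻¹' t | mγ.comap Z⟧ =ᵐ[P] P⟦X ⁻¹' s | mγ.comap Z⟧ * P⟦Y ⁻¹' t | mγ.comap Z⟧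

/-- `X ⊥ Y | Z`, where `Z` is indexed by the set `C`: unconditional independence if `C = ∅`. -/
def CondIndepIndexed {ι Ω α β γ : Type*} [MeasurableSpace Ω] [MeasurableSpace α]
    [MeasurableSpace β] [MeasurableSpace γ] (C : Finset ι)
    (X : Ω → α) (Y : Ω → β) (Z : Ω → γ) (P : Measure Ω) : Prop :=
  (C = ∅ → IndepFun X Y P) ∧ (C.Nonempty → CondIndepGiven X Y Z P)

/-! ### Point measures and Poisson processes -/

/-- An s-finite measure with values in `{0, 1, …, ∞}`. -/
def IsPointMeasure {S : Type*} [MeasurableSpace S] (μ : Measure S) : Prop :=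
  SFinite μ ∧ ∀ G, MeasurableSet G → ∃ n : ℕ∞, μ G = (n : ℝ≥0∞)

/-- `ξ` is a Poisson process with mean measure `Λ` on the probability space `(Ω, P)`. The σ-field
on `Measure S` is the one generated by the evaluations at measurable sets. -/
structure IsPoissonProcess {Ω S : Type*} [MeasurableSpace Ω] [MeasurableSpace S]
    (ξ : Ω → Measure S) (Λ : Measure S) (P : Measure Ω) : Prop where
  measurable : Measurable ξ
  isPointMeasure : ∀ ω, IsPointMeasure (ξ ω)
  law_of_finite : ∀ G, MeasurableSet G → Λ G ≠ ∞ →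
    P.map (fun ω => ξ ω G) = (poissonMeasure (Λ G).toNNReal).map (fun n : ℕ => (n : ℝ≥0∞))
  law_of_infinite : ∀ G, MeasurableSet G → Λ G = ∞ → ∀ᵐ ω ∂P, ξ ω G = ∞
  indep : ∀ (m : ℕ) (G : Fin m → Set S), (∀ i, MeasurableSet (G i)) →
    Pairwise (Function.onFun Disjoint G) → iIndepFun (fun i ω => ξ ω (G i)) P

/-! ### Punctured product spaces -/

section Product

variable {ι : Type*} {E : ι → Type*}

/-- The product space with the distinguished point `o` removed; it carries the trace of the
product σ-field. For `A : Finset ι`, the punctured space over `A` is `Punctured (A.restrict o)`. -/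
abbrev Punctured (o : ∀ i, E i) : Type _ := {y : ∀ i, E i // y ≠ o}

/-- The coordinates `y_A = (y_i)_{i ∈ A}` of a point of the punctured product space. -/
def coords (o : ∀ i, E i) (A : Finset ι) (y : Punctured o) : ∀ i : A, E i := A.restrict y.1

/-- The localizing sets of the product: `⋃ i, {y | y i ∈ L h i}`. -/
def prodLoc (L : ℕ → ∀ i, Set (E i)) (h : ℕ) : Set (∀ i, E i) := {y | ∃ i, y i ∈ L h i}

/-- A set in the product space is bounded if it lies in one of the localizing sets. -/
def IsBdd (L : ℕ → ∀ i, Set (E i)) (G : Set (∀ i, E i)) : Prop := ∃ h, G ⊆ prodLoc L h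

variable [∀ i, MeasurableSpace (E i)]

/-- The mass that a measure on the punctured space gives to `{y ∈ G, y ≠ o}`. -/
noncomputable def mass (o : ∀ i, E i) (Λ : Measure (Punctured o)) (G : Set (∀ i, E i)) : ℝ≥0∞ :=
  Λ (Subtype.val ⁻¹' G)

/-- The standing assumptions on the localizing sets and on the measure `Λ` (the spaces `E i` being
standard Borel is a type class assumption). -/
structure LocalizedExplosive (o : ∀ i, E i) (L : ℕ → ∀ i, Set (E i))
    (Λ : Measure (Punctured o)) : Prop where
  measurableSet_loc : ∀ h i, MeasurableSet (L h i)
  loc_subset_succ : ∀ h i, L h i ⊆ L (h + 1) i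
  iUnion_loc : ∀ i, ⋃ h, L h i = {o i}ᶜ
  locallyFinite : ∀ G : Set (∀ i, E i), MeasurableSet G → IsBdd L G → mass o Λ G < ∞
  explosive : ∀ A B : Finset ι, Disjoint A B → A.Nonempty →
    Λ {y | coords o A y ≠ A.restrict o ∧ coords o B y = B.restrict o} = 0 ∨
    Λ {y | coords o A y ≠ A.restrict o ∧ coords o B y = B.restrict o} = ∞

/-- The marginal measure induced by `Λ` on the punctured product space over `D`. -/
noncomputable def marginal (o : ∀ i, E i) (Λ : Measure (Punctured o)) (D : Finset ι) :
    Measure (Punctured (D.restrict o)) :=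
  (Λ.map (coords o D)).comap Subtype.val

/-- `Y_A ⊥ Y_B | Y_C` for `Y` distributed according to the normalized restriction of `Λ` to `Q`. -/
def CondIndepOn (o : ∀ i, E i) (Λ : Measure (Punctured o)) (A B C : Finset ι)
    (Q : Set (∀ i, E i)) : Prop :=
  CondIndepIndexed C (coords o A) (coords o B) (coords o C) (cond Λ (Subtype.val ⁻¹' Q))

/-- Conditional independence `A ⊥ B | C` for `Λ`, when `A, B, C` partition the index set:
conditional independence on all bounded product sets of positive mass. -/
def AdmitsCondIndep (o : ∀ i, E i) (L : ℕ → ∀ i, Set (E i)) (Λ : Measure (Punctured o))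
    (A B C : Finset ι) : Prop :=
  ∀ R : ∀ i, Set (E i), (∀ i, MeasurableSet (R i)) → 0 < mass o Λ (Set.univ.pi R) →
    IsBdd L (Set.univ.pi R) → CondIndepOn o Λ A B C (Set.univ.pi R)

/-- The reduced test sets `{y | y i ∈ L h i}`. -/
def slab (L : ℕ → ∀ i, Set (E i)) (h : ℕ) (i : ι) : Set (∀ i, E i) := {y | y i ∈ L h i}

/-- Conditional independence on all reduced test sets of positive mass with coordinate in `I`. -/
def CondIndepOnSlabs (o : ∀ i, E i) (L : ℕ → ∀ i, Set (E i)) (Λ : Measure (Punctured o))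
    (A B C I : Finset ι) : Prop :=
  ∀ i ∈ I, ∀ h, 0 < mass o Λ (slab L h i) → CondIndepOn o Λ A B C (slab L h i)

/-- `Λ(y_A ≠ o_A, y_B ≠ o_B, y_C = o_C) = 0`; if `C = ∅` the condition on `y_C` is void. -/
def NullOffC (o : ∀ i, E i) (Λ : Measure (Punctured o)) (A B C : Finset ι) : Prop :=
  Λ {y | coords o A y ≠ A.restrict o ∧ coords o B y ≠ B.restrict o ∧
    coords o C y = C.restrict o} = 0

/-- `κ` is a probability kernel that disintegrates the restriction of `Λ` to `{y_C ≠ o_C}` with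
respect to the marginal of `Λ` on the punctured space over `C`. -/
def IsDisintegration (o : ∀ i, E i) (Λ : Measure (Punctured o)) (A B C : Finset ι)
    (κ : Kernel (Punctured (C.restrict o)) ((∀ i : A, E i) × (∀ i : B, E i))) : Prop :=
  IsMarkovKernel κ ∧
  ∀ G : Set (Punctured (C.restrict o) × ((∀ i : A, E i) × (∀ i : B, E i))), MeasurableSet G →
    Λ {y | ∃ hy : coords o C y ≠ C.restrict o,
      (⟨coords o C y, hy⟩, (coords o A y, coords o B y)) ∈ G} =
    ∫⁻ z, κ z {w | (z, w) ∈ G} ∂(marginal o Λ C)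

/-- The kernel `κ` is, almost everywhere, the product of its two marginal kernels. -/
def Factorizes (o : ∀ i, E i) (Λ : Measure (Punctured o)) (A B C : Finset ι)
    (κ : Kernel (Punctured (C.restrict o)) ((∀ i : A, E i) × (∀ i : B, E i))) : Prop :=
  ∀ᵐ z ∂(marginal o Λ C), κ z = (κ.fst z).prod (κ.snd z)

/-- The projection of a point process to the (non-punctured) product space over `I`. -/
noncomputable def proj {Ω : Type*} (o : ∀ i, E i) (ξ : Ω → Measure (Punctured o)) (I : Finset ι)
    (ω : Ω) : Measure (∀ i : I, E i) := (ξ ω).map (coords o I)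

end Product

end PuncturedCI

open PuncturedCI

/-!
The conditional Laplace functional of `∫ v (y_A, y_B) dξ` given the projection to the coordinates in
`C` of `ξ` on `{y_C ≠ o_C}` is explicit: it is the exponential of minus the sum of
`∫_{y_C = o_C} (1 - exp (-v)) dΛ` and of `-log κ_z (exp (-v))` over the points `z` of the
projection. Conditional independence of `ξ_A` and `ξ_B` says that it is multiplicative in
`v = f (y_A) + g (y_B)`. This is the case if `κ_z` is almost everywhere a product measure and `Λ`
does not charge `{y_A ≠ o_A, y_B ≠ o_B, y_C = o_C}`; conversely, it suffices to let `f` and `g` take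
only the values `0` and `∞`, that is, to compare void probabilities. Explosiveness makes the number
of points projected to `o_C` deterministic (`0` or `∞`), so conditioning on `ξ_C` is the same as
conditioning on its restriction to `{y_C ≠ o_C}`.

Under a possibly infinite measure conditional independence localizes to sets determined by `y_C`, so
the factorization of `κ` is equivalent to conditional independence on the sets `R_{h,c}`, `c ∈ C`.
On a set `R_{h,v}`, `v ∈ A`, conditional independence makes the proportion of `{y_B ∈ t}` in the
mass of `{y_v ∈ L_{h,v}, y_C = o_C}` independent of `h`. By explosiveness this mass vanishes for all
`h` or tends to infinity, so a set `{y_B ∈ t}` of finite mass has proportion zero: `Λ` does not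
charge `{y_A ≠ o_A, y_B ≠ o_B, y_C = o_C}`.
-/

namespace PuncturedCI

/-! ### Exponential and logarithm on `[0, ∞]` -/

/-- The function `x ↦ exp (-x)` from `[0, ∞]` onto `[0, 1]`. -/
noncomputable def expNeg (x : ℝ≥0∞) : ℝ≥0∞ := EReal.exp (-(x : EReal))

/-- The function `p ↦ -log p` on `[0, 1]`, the inverse of `expNeg`; it is truncated to `0` on
`[1, ∞]`. -/
noncomputable def negLog (p : ℝ≥0∞) : ℝ≥0∞ := (-(ENNReal.log p)).toENNReal

lemma expNeg_zero : expNeg 0 = 1 := by simp [expNeg]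

lemma expNeg_top : expNeg ∞ = 0 := by simp [expNeg]

lemma expNeg_le_one (x : ℝ≥0∞) : expNeg x ≤ 1 := by
  simp [expNeg, EReal.neg_le_zero, EReal.coe_ennreal_nonneg]

lemma expNeg_ne_top (x : ℝ≥0∞) : expNeg x ≠ ∞ := ne_top_of_le_ne_top (by simp) (expNeg_le_one x)

lemma expNeg_add (x y : ℝ≥0∞) : expNeg (x + y) = expNeg x * expNeg y := by
  rw [expNeg, expNeg, expNeg, ← EReal.exp_add, EReal.coe_ennreal_add, EReal.neg_add,
    sub_eq_add_neg]
  · exact .inl (EReal.coe_ennreal_ne_bot x)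
  · exact .inr (EReal.coe_ennreal_ne_bot y)

lemma expNeg_strictAnti : StrictAnti expNeg := fun x y hxy => by
  simpa [expNeg, EReal.neg_lt_neg_iff] using hxy

lemma expNeg_injective : Function.Injective expNeg := expNeg_strictAnti.injective

@[fun_prop]
lemma continuous_expNeg : Continuous expNeg :=
  ENNReal.continuous_exp.comp (continuous_neg.comp continuous_coe_ennreal_ereal)

@[fun_prop]
lemma measurable_expNeg : Measurable expNeg := continuous_expNeg.measurable

@[fun_prop]
lemma measurable_negLog : Measurable negLog := ENNReal.measurable_log.neg.ereal_toENNReal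

lemma expNeg_negLog {p : ℝ≥0∞} (hp : p ≤ 1) : expNeg (negLog p) = p := by
  rw [expNeg, negLog, EReal.coe_toENNReal, neg_neg, ENNReal.exp_log]
  simpa using EReal.neg_le_neg_iff.2 (ENNReal.log_le_zero_iff.2 hp)

lemma negLog_expNeg (x : ℝ≥0∞) : negLog (expNeg x) = x :=
  expNeg_injective (expNeg_negLog (expNeg_le_one x))

lemma negLog_mul {p q : ℝ≥0∞} (hp : p ≤ 1) (hq : q ≤ 1) : negLog (p * q) = negLog p + negLog q :=
  expNeg_injective <| by
    rw [expNeg_add, expNeg_negLog hp, expNeg_negLog hq, expNeg_negLog (mul_le_one' hp hq)]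

lemma expNeg_sum {ι : Type*} (s : Finset ι) (x : ι → ℝ≥0∞) :
    expNeg (∑ i ∈ s, x i) = ∏ i ∈ s, expNeg (x i) := by
  classical
  induction s using Finset.induction_on with
  | empty => simp [expNeg_zero]
  | insert a s ha ih => rw [Finset.sum_insert ha, Finset.prod_insert ha, expNeg_add, ih]

lemma expNeg_mul_natCast (a : ℝ≥0∞) (n : ℕ) : expNeg (a * n) = expNeg a ^ n := by
  induction n with
  | zero => simp [expNeg_zero]
  | succ n ih => rw [Nat.cast_succ, mul_add, mul_one, expNeg_add, ih, pow_succ]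

lemma expNeg_coe (x : NNReal) : expNeg x = ENNReal.ofReal (Real.exp (-x)) := by
  have : -((x : ℝ≥0∞) : EReal) = ((-x : ℝ) : EReal) := by
    rw [EReal.coe_neg]; rfl
  rw [expNeg, this, EReal.exp_coe]

/-! ### Laplace functionals of random measures -/

section MomentProblem

variable {I : Type*}

lemma measure_ext_of_moments_of_finite [Finite I] {P Q : Measure (I → unitInterval)}
    [IsFiniteMeasure P] [IsFiniteMeasure Q]
    (h : ∀ n : I →₀ ℕ, ∫ x, n.prod (fun i k => (x i : ℝ) ^ k) ∂P =
      ∫ x, n.prod (fun i k => (x i : ℝ) ^ k) ∂Q) : P = Q := by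
  have := Fintype.ofFinite I
  let c : I → BoundedContinuousFunction (I → unitInterval) ℝ := fun i =>
    .mkOfCompact ⟨fun x => (x i : ℝ), by fun_prop⟩
  let A : StarSubalgebra ℝ (BoundedContinuousFunction (I → unitInterval) ℝ) :=
    { (MvPolynomial.aeval c).range with
      star_mem' := fun {a} ha => (show star a = a by ext; simp).symm ▸ ha }
  refine ext_of_forall_mem_subalgebra_integral_eq_of_polish (𝕜 := ℝ) (A := A) ?_ ?_
  · intro x y hxy
    obtain ⟨i, hi⟩ := Function.ne_iff.1 hxy
    have hc : c i ∈ A := ⟨.X i, by simp⟩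
    exact ⟨c i, ⟨_, ⟨c i, hc, rfl⟩, rfl⟩, fun h => hi (Subtype.ext h)⟩
  · rintro _ ⟨p, rfl⟩
    have expand (x) : MvPolynomial.aeval c p x =
        ∑ n ∈ p.support, p.coeff n * n.prod fun i k => (x i : ℝ) ^ k := by
      rw [MvPolynomial.aeval_def, MvPolynomial.eval₂_eq']
      simp [c, Finsupp.prod_fintype]
    have integrable (R : Measure (I → unitInterval)) [IsFiniteMeasure R] (n : I →₀ ℕ) :
        Integrable (fun x => p.coeff n * n.prod fun i k => (x i : ℝ) ^ k) R :=
      Continuous.integrable_of_hasCompactSupport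
        (by simp only [Finsupp.prod]; fun_prop) (.of_compactSpace _)
    change ∫ x, MvPolynomial.aeval c p x ∂P = ∫ x, MvPolynomial.aeval c p x ∂Q
    simp only [expand]
    rw [integral_finsetSum _ fun n _ => integrable P n,
      integral_finsetSum _ fun n _ => integrable Q n]
    simp only [integral_const_mul, h]

lemma measure_ext_of_moments {P Q : Measure (I → unitInterval)}
    [IsFiniteMeasure P] [IsFiniteMeasure Q]
    (h : ∀ n : I →₀ ℕ, ∫ x, n.prod (fun i k => (x i : ℝ) ^ k) ∂P =
      ∫ x, n.prod (fun i k => (x i : ℝ) ^ k) ∂Q) : P = Q := by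
  refine IsProjectiveLimit.unique (P := fun s : Finset I => Q.map s.restrict) (fun s => ?_)
    (fun s => rfl)
  have hs : Measurable (s.restrict (π := fun _ => unitInterval)) := by fun_prop
  refine measure_ext_of_moments_of_finite fun n => ?_
  have hc : Continuous fun x : s → unitInterval => n.prod fun i k => (x i : ℝ) ^ k := by
    simp only [Finsupp.prod]; fun_prop
  rw [integral_map hs.aemeasurable hc.aestronglyMeasurable,
    integral_map hs.aemeasurable hc.aestronglyMeasurable]
  have := h (n.embDomain (.subtype _))
  simp only [Finsupp.prod_embDomain] at this
  exact this

end MomentProblem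

section Laplace

variable {α : Type*} [MeasurableSpace α]

/-- The coordinates `(exp (-m G))`, indexed by the measurable sets `G`, of a measure `m`. They embed
the space of measures into a cube. -/
noncomputable def expNegCoords (m : Measure α) (G : {G : Set α // MeasurableSet G}) :
    unitInterval :=
  ⟨(expNeg (m G)).toReal, ENNReal.toReal_nonneg, ENNReal.toReal_mono (by simp) (expNeg_le_one _)⟩

lemma measurable_expNegCoords : Measurable (expNegCoords (α := α)) :=
  measurable_pi_lambda _ fun G =>
    ((measurable_expNeg.comp (Measure.measurable_coe G.2)).ennreal_toReal).subtype_mk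

lemma comap_expNegCoords :
    (inferInstance : MeasurableSpace (_ → unitInterval)).comap (expNegCoords (α := α)) =
      Measure.instMeasurableSpace := by
  refine le_antisymm measurable_expNegCoords.comap_le ?_
  set m₀ := (inferInstance : MeasurableSpace (_ → unitInterval)).comap (expNegCoords (α := α))
  suffices Measurable[m₀, Measure.instMeasurableSpace] (id : Measure α → Measure α) from
    MeasurableSpace.comap_id.symm.trans_le this.comap_le
  refine Measure.measurable_of_measurable_coe _ fun G hG => ?_
  have : (fun m : Measure α => m G) =
      fun m => negLog (ENNReal.ofReal (expNegCoords m ⟨G, hG⟩)) := by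
    funext m
    simp [expNegCoords, ENNReal.ofReal_toReal (expNeg_ne_top _), negLog_expNeg]
  simp only [id, this]
  have hcoord : Measurable[m₀] fun m : Measure α => expNegCoords m ⟨G, hG⟩ :=
    (measurable_pi_apply (X := fun _ => unitInterval) _).comp (comap_measurable _)
  exact measurable_negLog.comp (measurable_subtype_coe.comp hcoord).ennreal_ofReal

lemma prod_expNegCoords_pow (n : {G : Set α // MeasurableSet G} →₀ ℕ) (m : Measure α) :
    n.prod (fun G k => (expNegCoords m G : ℝ) ^ k) =
      (expNeg (∫⁻ x, ∑ G ∈ n.support, n G * G.1.indicator 1 x ∂m)).toReal := by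
  rw [lintegral_finsetSum (f := fun G x => (n G : ℝ≥0∞) * G.1.indicator 1 x) _
    fun G _ => measurable_const.mul (measurable_one.indicator G.2), expNeg_sum,
    ENNReal.toReal_prod]
  refine Finset.prod_congr rfl fun G _ => ?_
  rw [lintegral_const_mul _ (measurable_one.indicator G.2), lintegral_indicator_one G.2, mul_comm,
    expNeg_mul_natCast, ENNReal.toReal_pow]
  rfl

lemma measure_ext_of_laplace {μ ν : Measure (Measure α)} [IsFiniteMeasure μ] [IsFiniteMeasure ν]
    (h : ∀ f : α → ℝ≥0∞, Measurable f →
      ∫⁻ m, expNeg (∫⁻ x, f x ∂m) ∂μ = ∫⁻ m, expNeg (∫⁻ x, f x ∂m) ∂ν) : μ = ν := by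
  have map_eq : μ.map expNegCoords = ν.map expNegCoords := by
    refine measure_ext_of_moments fun n => ?_
    have hp : Measurable fun x : {G : Set α // MeasurableSet G} → unitInterval =>
        n.prod fun i k => (x i : ℝ) ^ k := by
      simp only [Finsupp.prod]; fun_prop
    have hf : Measurable fun x => ∑ G ∈ n.support, n G * G.1.indicator (1 : α → ℝ≥0∞) x :=
      Finset.measurable_fun_sum _ fun G _ => measurable_const.mul (measurable_one.indicator G.2)
    have hm := measurable_expNeg.comp (Measure.measurable_lintegral hf)
    have moment (ρ : Measure (Measure α)) :
        ∫ x, n.prod (fun i k => (x i : ℝ) ^ k) ∂ρ.map expNegCoords =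
          (∫⁻ m, expNeg (∫⁻ x, ∑ G ∈ n.support, n G * G.1.indicator 1 x ∂m) ∂ρ).toReal := by
      rw [integral_map measurable_expNegCoords.aemeasurable hp.aestronglyMeasurable]
      simp only [prod_expNegCoords_pow]
      exact integral_toReal hm.aemeasurable (.of_forall fun m => (expNeg_ne_top _).lt_top)
    rw [moment, moment, h _ hf]
  ext s hs
  rw [← comap_expNegCoords] at hs
  obtain ⟨t, ht, rfl⟩ := hs
  rw [← Measure.map_apply measurable_expNegCoords ht, map_eq,
    Measure.map_apply measurable_expNegCoords ht]

lemma lintegral_mul_comp_eq_of_laplace {Ω : Type*} [MeasurableSpace Ω] {P : Measure Ω}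
    {ξ : Ω → Measure α} (hξ : Measurable ξ) {W W' : Ω → ℝ≥0∞} (hW : Measurable W)
    (hW' : Measurable W') (fin : ∫⁻ ω, W ω ∂P ≠ ∞)
    (h : ∀ f : α → ℝ≥0∞, Measurable f →
      ∫⁻ ω, W ω * expNeg (∫⁻ x, f x ∂ξ ω) ∂P = ∫⁻ ω, W' ω * expNeg (∫⁻ x, f x ∂ξ ω) ∂P)
    {φ : Measure α → ℝ≥0∞} (hφ : Measurable φ) :
    ∫⁻ ω, W ω * φ (ξ ω) ∂P = ∫⁻ ω, W' ω * φ (ξ ω) ∂P := by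
  have weighted {U : Ω → ℝ≥0∞} (hU : Measurable U) {ψ : Measure α → ℝ≥0∞} (hψ : Measurable ψ) :
      ∫⁻ m, ψ m ∂(P.withDensity U).map ξ = ∫⁻ ω, U ω * ψ (ξ ω) ∂P := by
    rw [lintegral_map hψ hξ]
    exact lintegral_withDensity_eq_lintegral_mul _ hU (hψ.comp hξ)
  have fin' : ∫⁻ ω, W' ω ∂P ≠ ∞ := by
    have := h 0 measurable_zero
    simp only [Pi.zero_apply, lintegral_zero, expNeg_zero, mul_one] at this
    rwa [← this]
  have := isFiniteMeasure_withDensity fin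
  have := isFiniteMeasure_withDensity fin'
  have eq : (P.withDensity W).map ξ = (P.withDensity W').map ξ := by
    refine measure_ext_of_laplace fun f hf => ?_
    have hm := measurable_expNeg.comp (Measure.measurable_lintegral hf)
    exact (weighted hW hm).trans ((h f hf).trans (weighted hW' hm).symm)
  rw [← weighted hW hφ, eq, weighted hW' hφ]

end Laplace

/-! ### The Laplace functional of a Poisson process -/

lemma one_sub_expNeg_eq_zero {a : ℝ≥0∞} : 1 - expNeg a = 0 ↔ a = 0 := by
  refine ⟨fun h => expNeg_injective ?_, fun h => by simp [h, expNeg_zero]⟩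
  rw [expNeg_zero]
  exact le_antisymm (expNeg_le_one a) (tsub_eq_zero_iff_le.1 h)

lemma lintegral_pow_poissonMeasure (r : NNReal) {p : ℝ≥0∞} (hp : p ≤ 1) :
    ∫⁻ n : ℕ, p ^ n ∂(poissonMeasure r) = expNeg ((1 - p) * r) := by
  lift p to NNReal using (hp.trans_lt ENNReal.one_lt_top).ne
  have hp' : p ≤ 1 := by exact_mod_cast hp
  have term (n : ℕ) : ENNReal.ofReal (Real.exp (-r) * r ^ n / n.factorial) * (p : ℝ≥0∞) ^ n =
      ENNReal.ofReal (Real.exp (-r) * ((r * p : ℝ) ^ n / n.factorial)) := by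
    rw [← ENNReal.ofReal_coe_nnreal, ← ENNReal.ofReal_pow (NNReal.coe_nonneg p),
      ← ENNReal.ofReal_mul (by positivity)]
    congr 1
    ring
  have series := (NormedSpace.expSeries_div_hasSum_exp (r * p : ℝ)).mul_left (Real.exp (-r))
  have exponent : (1 - (p : ℝ≥0∞)) * r = ((1 - p) * r : NNReal) := by push_cast; rfl
  rw [poissonMeasure, lintegral_sum_measure]
  simp only [lintegral_smul_measure, lintegral_dirac, smul_eq_mul, term]
  rw [← ENNReal.ofReal_tsum_of_nonneg (fun n => by positivity) series.summable, series.tsum_eq,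
    ← Real.exp_eq_exp_ℝ, ← Real.exp_add, exponent, expNeg_coe]
  congr 2
  rw [NNReal.coe_mul, NNReal.coe_sub hp']
  push_cast
  ring

namespace IsPoissonProcess

variable {Ω S : Type*} [MeasurableSpace Ω] [MeasurableSpace S] {ξ : Ω → Measure S}
  {Λ : Measure S} {P : Measure Ω}

lemma iIndepFun_of_finite {κ : Type*} [Finite κ] (hξ : IsPoissonProcess ξ Λ P) {G : κ → Set S}
    (hG : ∀ i, MeasurableSet (G i)) (disj : Pairwise (Function.onFun Disjoint G)) :
    iIndepFun (fun i ω => ξ ω (G i)) P := by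
  have e := Finite.equivFin κ
  have := hξ.indep _ (G ∘ e.symm) (fun i => hG _) fun i j hij =>
    disj (e.symm.injective.ne hij)
  simpa only [Function.comp_apply, Equiv.symm_apply_apply] using this.precomp e.injective

lemma measurable_apply (hξ : IsPoissonProcess ξ Λ P) {G : Set S} (hG : MeasurableSet G) :
    Measurable fun ω => ξ ω G :=
  (Measure.measurable_coe hG).comp hξ.measurable

variable [IsProbabilityMeasure P]

lemma lintegral_expNeg_mul (hξ : IsPoissonProcess ξ Λ P) (a : ℝ≥0∞) {G : Set S}
    (hG : MeasurableSet G) :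
    ∫⁻ ω, expNeg (a * ξ ω G) ∂P = expNeg ((1 - expNeg a) * Λ G) := by
  by_cases hfin : Λ G = ∞
  · have : ∀ᵐ ω ∂P, expNeg (a * ξ ω G) = expNeg (a * ∞) := by
      filter_upwards [hξ.law_of_infinite G hG hfin] with ω hω using by rw [hω]
    rw [lintegral_congr_ae this, hfin, lintegral_const, measure_univ, mul_one]
    by_cases ha : a = 0
    · simp [ha, expNeg_zero]
    · rw [ENNReal.mul_top ha, ENNReal.mul_top (one_sub_expNeg_eq_zero.not.2 ha)]
  · have hm : Measurable fun x : ℝ≥0∞ => expNeg (a * x) := by fun_prop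
    rw [← lintegral_map hm (hξ.measurable_apply hG), hξ.law_of_finite G hG hfin,
      lintegral_map hm (by fun_prop)]
    simp_rw [expNeg_mul_natCast]
    rw [lintegral_pow_poissonMeasure _ (expNeg_le_one a), ENNReal.coe_toNNReal hfin]

lemma lintegral_expNeg_simpleFunc (hξ : IsPoissonProcess ξ Λ P) (u : SimpleFunc S ℝ≥0∞) :
    ∫⁻ ω, expNeg (∫⁻ x, u x ∂ξ ω) ∂P = expNeg (∫⁻ x, (1 - expNeg (u x)) ∂Λ) := by
  have left (ω) : ∫⁻ x, u x ∂ξ ω = ∑ a ∈ u.range, a * ξ ω (u ⁻¹' {a}) := by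
    rw [SimpleFunc.lintegral_eq_lintegral]; rfl
  have right : ∫⁻ x, (1 - expNeg (u x)) ∂Λ = ∑ a ∈ u.range, (1 - expNeg a) * Λ (u ⁻¹' {a}) := by
    rw [← SimpleFunc.map_lintegral, ← SimpleFunc.lintegral_eq_lintegral]; rfl
  have indep : iIndepFun (fun (a : u.range) ω => expNeg (a * ξ ω (u ⁻¹' {a.1}))) P := by
    have := hξ.iIndepFun_of_finite (G := fun a : u.range => u ⁻¹' {a.1})
      (fun a => u.measurableSet_fiber _)
      fun a b hab => Disjoint.preimage _ (Set.disjoint_singleton.2 (Subtype.coe_ne_coe.2 hab))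
    exact this.comp (fun a x => expNeg (a * x)) fun a => by fun_prop
  simp_rw [left, right, expNeg_sum, ← Finset.prod_coe_sort u.range]
  rw [lintegral_prod_eq_prod_lintegral_of_indepFun Finset.univ _ indep fun a =>
    measurable_expNeg.comp ((hξ.measurable_apply (u.measurableSet_fiber _)).const_mul _)]
  exact Finset.prod_congr rfl fun a _ => hξ.lintegral_expNeg_mul _ (u.measurableSet_fiber _)

theorem lintegral_expNeg_lintegral (hξ : IsPoissonProcess ξ Λ P) {u : S → ℝ≥0∞}
    (hu : Measurable u) :
    ∫⁻ ω, expNeg (∫⁻ x, u x ∂ξ ω) ∂P = expNeg (∫⁻ x, (1 - expNeg (u x)) ∂Λ) := by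
  have mono (x) : Monotone fun n => SimpleFunc.eapprox u n x := fun _ _ hnm =>
    SimpleFunc.monotone_eapprox u hnm x
  have approx (m : Measure S) : Filter.Tendsto (fun n => ∫⁻ x, SimpleFunc.eapprox u n x ∂m)
      Filter.atTop (nhds (∫⁻ x, u x ∂m)) :=
    lintegral_tendsto_of_tendsto_of_monotone (fun n => (SimpleFunc.measurable _).aemeasurable)
      (.of_forall mono) (.of_forall fun x => SimpleFunc.tendsto_eapprox hu x)
  have left : Filter.Tendsto (fun n => ∫⁻ ω, expNeg (∫⁻ x, SimpleFunc.eapprox u n x ∂ξ ω) ∂P)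
      Filter.atTop (nhds (∫⁻ ω, expNeg (∫⁻ x, u x ∂ξ ω) ∂P)) :=
    tendsto_lintegral_of_dominated_convergence (fun _ => 1)
      (fun n => measurable_expNeg.comp
        ((Measure.measurable_lintegral (SimpleFunc.measurable _)).comp hξ.measurable))
      (fun n => .of_forall fun ω => expNeg_le_one _) (by simp)
      (.of_forall fun ω => (continuous_expNeg.tendsto _).comp (approx _))
  have right : Filter.Tendsto (fun n => ∫⁻ x, (1 - expNeg (SimpleFunc.eapprox u n x)) ∂Λ)
      Filter.atTop (nhds (∫⁻ x, (1 - expNeg (u x)) ∂Λ)) :=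
    lintegral_tendsto_of_tendsto_of_monotone
      (fun n => (measurable_const.sub
        (measurable_expNeg.comp (SimpleFunc.measurable _))).aemeasurable)
      (.of_forall fun x n m hnm =>
        tsub_le_tsub_left (expNeg_strictAnti.antitone (mono x hnm)) _)
      (.of_forall fun x => ENNReal.Tendsto.sub tendsto_const_nhds
        ((continuous_expNeg.tendsto _).comp (SimpleFunc.tendsto_eapprox hu x)) (by simp))
  simp_rw [hξ.lintegral_expNeg_simpleFunc] at left
  exact tendsto_nhds_unique left ((continuous_expNeg.tendsto _).comp right)

end IsPoissonProcess

/-! ### Conditional independence under infinite measures -/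

section CondProb

variable {Ω γ : Type*} [MeasurableSpace Ω] [MeasurableSpace γ] {Z : Ω → γ} {m : Measure Ω}
  {a b : γ → ℝ≥0∞} {F : Set Ω}

/-- `b ∘ Z` is a version of the conditional probability of the event `F` given `Z`, under a measure
that need not be normalized. -/
def IsCondProb (b : γ → ℝ≥0∞) (F : Set Ω) (Z : Ω → γ) (m : Measure Ω) : Prop :=
  ∀ u, MeasurableSet u → m (F ∩ Z ⁻¹' u) = ∫⁻ ω in Z ⁻¹' u, b (Z ω) ∂m

lemma isCondProb_iff_map_eq (hZ : Measurable Z) (hb : Measurable b) :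
    IsCondProb b F Z m ↔ (m.restrict F).map Z = (m.map Z).withDensity b := by
  rw [IsCondProb, Measure.ext_iff]
  refine forall₂_congr fun u hu => ?_
  rw [Measure.map_apply hZ hu, Measure.restrict_apply (hZ hu), withDensity_apply _ hu,
    Set.inter_comm, setLIntegral_map hu hb hZ]

lemma exists_isCondProb [IsFiniteMeasure m] (hZ : Measurable Z) (F : Set Ω) :
    ∃ b : γ → ℝ≥0∞, Measurable b ∧ IsCondProb b F Z m := by
  refine ⟨((m.restrict F).map Z).rnDeriv (m.map Z), Measure.measurable_rnDeriv _ _, ?_⟩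
  rw [isCondProb_iff_map_eq hZ (Measure.measurable_rnDeriv _ _), Measure.withDensity_rnDeriv_eq]
  exact (Measure.absolutelyContinuous_of_le Measure.restrict_le_self).map hZ

namespace IsCondProb

lemma setLIntegral_comp (h : IsCondProb b F Z m) (hZ : Measurable Z) (hb : Measurable b)
    {φ : γ → ℝ≥0∞} (hφ : Measurable φ) :
    ∫⁻ ω in F, φ (Z ω) ∂m = ∫⁻ ω, b (Z ω) * φ (Z ω) ∂m := by
  rw [← lintegral_map hφ hZ, (isCondProb_iff_map_eq hZ hb).1 h,
    lintegral_withDensity_eq_lintegral_mul _ hb hφ, lintegral_map (hb.mul hφ) hZ]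
  rfl

lemma ae_eq [IsFiniteMeasure m] (ha : IsCondProb a F Z m) (hb : IsCondProb b F Z m)
    (hZ : Measurable Z) (ham : Measurable a) (hbm : Measurable b) :
    ∀ᵐ ω ∂m, a (Z ω) = b (Z ω) := by
  have := Measure.isFiniteMeasure_map m Z
  rw [isCondProb_iff_map_eq hZ ham] at ha
  rw [isCondProb_iff_map_eq hZ hbm] at hb
  exact ae_of_ae_map hZ.aemeasurable <|
    (withDensity_eq_iff_of_sigmaFinite ham.aemeasurable hbm.aemeasurable).1 (ha.symm.trans hb)

lemma congr_ae (h : IsCondProb a F Z m) (hab : ∀ᵐ ω ∂m, a (Z ω) = b (Z ω)) :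
    IsCondProb b F Z m := fun u hu =>
  (h u hu).trans (lintegral_congr_ae (ae_restrict_of_ae hab))

lemma smul (h : IsCondProb b F Z m) (c : ℝ≥0∞) : IsCondProb b F Z (c • m) := fun u hu => by
  rw [Measure.smul_apply, Measure.restrict_smul, lintegral_smul_measure, h u hu]

lemma restrict_preimage (h : IsCondProb b F Z m) (hZ : Measurable Z) {u : Set γ}
    (hu : MeasurableSet u) : IsCondProb b F Z (m.restrict (Z ⁻¹' u)) := fun v hv => by
  rw [Measure.restrict_apply' (hZ hu), Set.inter_assoc, Measure.restrict_restrict (hZ hv),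
    ← Set.preimage_inter, h _ (hv.inter hu)]

lemma ae_le_one [IsFiniteMeasure m] (h : IsCondProb b F Z m) (hZ : Measurable Z)
    (hb : Measurable b) : ∀ᵐ ω ∂m, b (Z ω) ≤ 1 := by
  have := Measure.isFiniteMeasure_map m Z
  suffices b ≤ᵐ[m.map Z] 1 from ae_of_ae_map hZ.aemeasurable this
  refine ae_le_of_forall_setLIntegral_le_of_sigmaFinite hb fun u hu _ => ?_
  simp only [Pi.one_apply]
  rw [setLIntegral_map hu hb hZ, ← h u hu, setLIntegral_one, Measure.map_apply hZ hu]
  exact measure_mono Set.inter_subset_right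

lemma condExp_ae_eq [IsFiniteMeasure m] (h : IsCondProb b F Z m) (hZ : Measurable Z)
    (hF : MeasurableSet F) (hb : Measurable b) :
    m⟦F | MeasurableSpace.comap Z inferInstance⟧ =ᵐ[m] fun ω => (b (Z ω)).toReal := by
  have le_one := h.ae_le_one hZ hb
  have hm : Measurable[MeasurableSpace.comap Z inferInstance] fun ω => (b (Z ω)).toReal :=
    hb.ennreal_toReal.comp (comap_measurable Z)
  have integrable : Integrable (fun ω => (b (Z ω)).toReal) m := by
    refine Integrable.of_bound (hm.mono hZ.comap_le le_rfl).aestronglyMeasurable 1 ?_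
    filter_upwards [le_one] with ω hω
    rw [Real.norm_of_nonneg ENNReal.toReal_nonneg]
    exact ENNReal.toReal_mono ENNReal.one_ne_top hω
  refine (ae_eq_condExp_of_forall_setIntegral_eq hZ.comap_le
    ((integrable_const (1 : ℝ)).indicator hF) (fun _ _ _ => integrable.integrableOn) ?_
    hm.stronglyMeasurable.aestronglyMeasurable).symm
  rintro _ ⟨u, hu, rfl⟩ _
  rw [integral_toReal (f := fun ω => b (Z ω)) (hb.comp hZ).aemeasurable
    ((ae_restrict_of_ae le_one).mono fun ω hω => hω.trans_lt ENNReal.one_lt_top), ← h u hu,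
    integral_indicator hF, Measure.restrict_restrict hF]
  simp [Measure.real]

end IsCondProb

end CondProb

section CondIndep

variable {Ω α β γ : Type*} [MeasurableSpace Ω] [MeasurableSpace α] [MeasurableSpace β]
  [MeasurableSpace γ] {X : Ω → α} {Y : Ω → β} {Z : Ω → γ} {m : Measure Ω}

/-- Conditional independence of `X` and `Y` given `Z` under a measure `m` that may be infinite:
the conditional probability of `{Y ∈ t}` given `X` and `Z` is a function of `Z` alone. Only this
one-sided form makes sense if `Z` does not have a σ-finite distribution. -/
def CondIndepUnder (X : Ω → α) (Y : Ω → β) (Z : Ω → γ) (m : Measure Ω) : Prop :=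
  ∀ t, MeasurableSet t → ∃ b : γ → ℝ≥0∞, Measurable b ∧
    ∀ s, MeasurableSet s → IsCondProb b (Y ⁻¹' t) Z (m.restrict (X ⁻¹' s))

lemma IsCondProb.restrict_iff_mul {a b : γ → ℝ≥0∞} {F F' : Set Ω} (hF : MeasurableSet F)
    (hZ : Measurable Z) (ham : Measurable a) (hbm : Measurable b) (ha : IsCondProb a F Z m) :
    IsCondProb b F' Z (m.restrict F) ↔ IsCondProb (fun z => a z * b z) (F ∩ F') Z m := by
  refine forall₂_congr fun u hu => ?_
  have : ∫⁻ ω in Z ⁻¹' u, b (Z ω) ∂m.restrict F = ∫⁻ ω in Z ⁻¹' u, a (Z ω) * b (Z ω) ∂m := by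
    have := ha.setLIntegral_comp hZ ham (hbm.indicator hu)
    rw [← lintegral_indicator (hZ hu), ← lintegral_indicator (hZ hu)]
    refine this.trans (lintegral_congr fun ω => ?_)
    by_cases hω : Z ω ∈ u <;> simp [hω]
  rw [this, Measure.restrict_apply' hF, Set.inter_comm, ← Set.inter_assoc]

lemma condIndepUnder_iff_mul [IsFiniteMeasure m] (hX : Measurable X) (hZ : Measurable Z) :
    CondIndepUnder X Y Z m ↔ ∀ s t, MeasurableSet s → MeasurableSet t →
      ∃ a b : γ → ℝ≥0∞, Measurable a ∧ Measurable b ∧ IsCondProb a (X ⁻¹' s) Z m ∧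
        IsCondProb b (Y ⁻¹' t) Z m ∧
        IsCondProb (fun z => a z * b z) (X ⁻¹' s ∩ Y ⁻¹' t) Z m := by
  constructor
  · intro h s t hs ht
    obtain ⟨b, hb, hbt⟩ := h t ht
    obtain ⟨a, ha, has⟩ := exists_isCondProb (m := m) hZ (X ⁻¹' s)
    exact ⟨a, b, ha, hb, has, by simpa using hbt Set.univ .univ,
      (has.restrict_iff_mul (hX hs) hZ ha hb).1 (hbt s hs)⟩
  · intro h t ht
    obtain ⟨b, hb, hbt⟩ := exists_isCondProb (m := m) hZ (Y ⁻¹' t)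
    refine ⟨b, hb, fun s hs => ?_⟩
    obtain ⟨a, b', ha, hb', has, hbt', hab⟩ := h s t hs ht
    refine ((has.restrict_iff_mul (hX hs) hZ ha hb').2 hab).congr_ae (ae_restrict_of_ae ?_)
    exact hbt'.ae_eq hbt hZ hb' hb

lemma condIndepGiven_iff_condIndepUnder [IsFiniteMeasure m] (hX : Measurable X)
    (hY : Measurable Y) (hZ : Measurable Z) :
    CondIndepGiven X Y Z m ↔ CondIndepUnder X Y Z m := by
  rw [condIndepUnder_iff_mul hX hZ]
  refine forall₄_congr fun s t hs ht => ⟨fun h => ?_, ?_⟩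
  · obtain ⟨a, ha, has⟩ := exists_isCondProb (m := m) hZ (X ⁻¹' s)
    obtain ⟨b, hb, hbt⟩ := exists_isCondProb (m := m) hZ (Y ⁻¹' t)
    obtain ⟨c, hc, hcst⟩ := exists_isCondProb (m := m) hZ (X ⁻¹' s ∩ Y ⁻¹' t)
    refine ⟨a, b, ha, hb, has, hbt, hcst.congr_ae ?_⟩
    filter_upwards [h, has.condExp_ae_eq hZ (hX hs) ha, hbt.condExp_ae_eq hZ (hY ht) hb,
      hcst.condExp_ae_eq hZ ((hX hs).inter (hY ht)) hc, has.ae_le_one hZ ha,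
      hbt.ae_le_one hZ hb, hcst.ae_le_one hZ hc] with ω hω ea eb ec la lb lc
    rw [ec, Pi.mul_apply, ea, eb, ← ENNReal.toReal_mul] at hω
    exact (ENNReal.toReal_eq_toReal_iff' (lc.trans_lt ENNReal.one_lt_top).ne
      ((mul_le_one' la lb).trans_lt ENNReal.one_lt_top).ne).1 hω
  · rintro ⟨a, b, ha, hb, has, hbt, hab⟩
    filter_upwards [has.condExp_ae_eq hZ (hX hs) ha, hbt.condExp_ae_eq hZ (hY ht) hb,
      hab.condExp_ae_eq hZ ((hX hs).inter (hY ht)) (ha.mul hb)] with ω ea eb eab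
    rw [eab, Pi.mul_apply, ea, eb, ENNReal.toReal_mul]

namespace CondIndepUnder

lemma smul (h : CondIndepUnder X Y Z m) (c : ℝ≥0∞) : CondIndepUnder X Y Z (c • m) :=
  fun t ht => (h t ht).imp fun b ⟨hb, hbt⟩ =>
    ⟨hb, fun s hs => by rw [Measure.restrict_smul]; exact (hbt s hs).smul c⟩

lemma restrict_left (h : CondIndepUnder X Y Z m) (hX : Measurable X) {s : Set α}
    (hs : MeasurableSet s) : CondIndepUnder X Y Z (m.restrict (X ⁻¹' s)) :=
  fun t ht => (h t ht).imp fun b ⟨hb, hbt⟩ => ⟨hb, fun s' hs' => by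
    rw [Measure.restrict_restrict (hX hs'), ← Set.preimage_inter]
    exact hbt _ (hs'.inter hs)⟩

lemma restrict_cond (h : CondIndepUnder X Y Z m) (hX : Measurable X) (hZ : Measurable Z)
    {u : Set γ} (hu : MeasurableSet u) : CondIndepUnder X Y Z (m.restrict (Z ⁻¹' u)) :=
  fun t ht => (h t ht).imp fun b ⟨hb, hbt⟩ => ⟨hb, fun s hs => by
    rw [Measure.restrict_comm (hX hs)]
    exact (hbt s hs).restrict_preimage hZ hu⟩

lemma of_ae_const_right {y₀ : β} (h : ∀ᵐ ω ∂m, Y ω = y₀) : CondIndepUnder X Y Z m := by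
  classical
  refine fun t _ => ⟨fun _ => if y₀ ∈ t then 1 else 0, measurable_const, fun s _ u _ => ?_⟩
  have hY : (Y ⁻¹' t ∩ Z ⁻¹' u : Set Ω) =ᵐ[m.restrict (X ⁻¹' s)]
      (if y₀ ∈ t then Z ⁻¹' u else ∅ : Set Ω) :=
    Filter.eventuallyEq_set.2 <| (ae_restrict_of_ae h).mono fun ω hω => by
      split_ifs with hy <;> simp [hω, hy]
  rw [measure_congr hY]
  split_ifs <;> simp

lemma of_ae_const_left [IsFiniteMeasure m] (hZ : Measurable Z) {x₀ : α} (h : ∀ᵐ ω ∂m, X ω = x₀) :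
    CondIndepUnder X Y Z m := by
  intro t _
  obtain ⟨b, hb, hbt⟩ := exists_isCondProb (m := m) hZ (Y ⁻¹' t)
  refine ⟨b, hb, fun s _ => ?_⟩
  by_cases hx : x₀ ∈ s
  · rwa [Measure.restrict_eq_self_of_ae_mem (h.mono fun ω hω => by simpa [hω])]
  · have : m (X ⁻¹' s) = 0 :=
      measure_eq_zero_iff_ae_notMem.2 (h.mono fun ω hω => by simpa [hω])
    simp [IsCondProb, Measure.restrict_eq_zero.2 this]

lemma of_restrict (hZ : Measurable Z) {U : Set γ} (hU : MeasurableSet U)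
    (h : CondIndepUnder X Y Z (m.restrict (Z ⁻¹' U)))
    (h' : CondIndepUnder X Y Z (m.restrict (Z ⁻¹' Uᶜ))) : CondIndepUnder X Y Z m := by
  classical
  intro t ht
  obtain ⟨b, hb, hbt⟩ := h t ht
  obtain ⟨b', hb', hbt'⟩ := h' t ht
  refine ⟨U.piecewise b b', hb.piecewise hU hb', fun s hs u hu => ?_⟩
  have on_part (V : Set γ) (hV : MeasurableSet V) (c : γ → ℝ≥0∞)
      (hc : IsCondProb c (Y ⁻¹' t) Z ((m.restrict (Z ⁻¹' V)).restrict (X ⁻¹' s))) :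
      m.restrict (X ⁻¹' s) (Y ⁻¹' t ∩ Z ⁻¹' u ∩ Z ⁻¹' V) =
        ∫⁻ ω in Z ⁻¹' u ∩ Z ⁻¹' V, c (Z ω) ∂m.restrict (X ⁻¹' s) := by
    have := hc u hu
    rwa [← Measure.restrict_comm (hZ hV), Measure.restrict_apply' (hZ hV),
      Measure.restrict_restrict (hZ hu)] at this
  rw [← measure_inter_add_sdiff _ (hZ hU), ← lintegral_inter_add_sdiff _ _ (hZ hU), Set.sdiff_eq,
    Set.sdiff_eq, ← Set.preimage_compl, on_part U hU b (hbt s hs),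
    on_part Uᶜ hU.compl b' (hbt' s hs)]
  congr 1
  · exact setLIntegral_congr_fun ((hZ hu).inter (hZ hU)) fun ω hω =>
      (Set.piecewise_eq_of_mem U _ _ hω.2).symm
  · exact setLIntegral_congr_fun ((hZ hu).inter (hZ hU.compl)) fun ω hω =>
      (Set.piecewise_eq_of_notMem _ _ _ hω.2).symm

lemma recode {α' β' γ' : Type*} [MeasurableSpace α'] [MeasurableSpace β'] [MeasurableSpace γ']
    {X' : Ω → α'} {Y' : Ω → β'} {Z' : Ω → γ'} {f : α → α'} {g : β → β'} {k : γ → γ'} {l : γ' → γ}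
    (h : CondIndepUnder X Y Z m) (hf : Measurable f) (hg : Measurable g)
    (hk : Measurable k) (hl : Measurable l) (hX' : ∀ᵐ ω ∂m, X' ω = f (X ω))
    (hY' : ∀ᵐ ω ∂m, Y' ω = g (Y ω)) (hZ' : ∀ᵐ ω ∂m, Z' ω = k (Z ω))
    (hZl : ∀ᵐ ω ∂m, Z ω = l (Z' ω)) : CondIndepUnder X' Y' Z' m := by
  intro t ht
  obtain ⟨b, hb, hbt⟩ := h _ (hg ht)
  refine ⟨fun z => b (l z), hb.comp hl, fun s hs u hu => ?_⟩
  have eX : X' ⁻¹' s =ᵐ[m] X ⁻¹' (f ⁻¹' s) :=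
    Filter.eventuallyEq_set.2 (hX'.mono fun ω hω => by simp [hω])
  have eYZ : (Y' ⁻¹' t ∩ Z' ⁻¹' u : Set Ω) =ᵐ[m] (Y ⁻¹' (g ⁻¹' t) ∩ Z ⁻¹' (k ⁻¹' u) : Set Ω) :=
    Filter.eventuallyEq_set.2 ((hY'.and hZ').mono fun ω hω => by simp [hω.1, hω.2])
  have eZ : Z' ⁻¹' u =ᵐ[m] Z ⁻¹' (k ⁻¹' u) :=
    Filter.eventuallyEq_set.2 (hZ'.mono fun ω hω => by simp [hω])
  rw [Measure.restrict_congr_set eX, measure_congr (ae_restrict_le eYZ), hbt _ (hf hs) _ (hk hu),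
    Measure.restrict_congr_set (ae_restrict_le eZ)]
  exact lintegral_congr_ae (ae_restrict_of_ae (ae_restrict_of_ae
    (hZl.mono fun ω hω => congrArg b hω)))

end CondIndepUnder

lemma condIndepUnder_iff_indepFun [IsProbabilityMeasure m] (hX : Measurable X) {z₀ : γ}
    (hz : ∀ᵐ ω ∂m, Z ω = z₀) :
    CondIndepUnder X Y Z m ↔ IndepFun X Y m := by
  classical
  rw [indepFun_iff_measure_inter_preimage_eq_mul]
  constructor
  · intro h s t hs ht
    obtain ⟨b, -, hbt⟩ := h t ht
    have prob (s : Set α) (hs : MeasurableSet s) :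
        m (X ⁻¹' s ∩ Y ⁻¹' t) = b z₀ * m (X ⁻¹' s) := by
      have := hbt s hs Set.univ .univ
      simp only [Set.preimage_univ, Set.inter_univ, Measure.restrict_univ,
        Measure.restrict_apply' (hX hs)] at this
      rw [Set.inter_comm, this, lintegral_congr_ae
        (ae_restrict_of_ae (hz.mono fun ω hω => congrArg b hω)), setLIntegral_const]
    have := prob Set.univ .univ
    simp only [Set.preimage_univ, Set.univ_inter, measure_univ, mul_one] at this
    rw [prob s hs, this, mul_comm]
  · intro h t ht
    refine ⟨fun _ => m (Y ⁻¹' t), measurable_const, fun s hs u _ => ?_⟩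
    have hZu (F : Set Ω) : m (F ∩ Z ⁻¹' u) = if z₀ ∈ u then m F else 0 := by
      split_ifs with hu
      · exact measure_congr (Filter.eventuallyEq_set.2 (hz.mono fun ω hω => by simp [hω, hu]))
      · exact measure_eq_zero_iff_ae_notMem.2 (hz.mono fun ω hω => by simp [hω, hu])
    rw [setLIntegral_const, Measure.restrict_apply' (hX hs), Measure.restrict_apply' (hX hs),
      Set.inter_right_comm, Set.inter_comm (Z ⁻¹' u), hZu, hZu]
    split_ifs
    · rw [Set.inter_comm, h s t hs ht, mul_comm]
    · simp

lemma condIndepIndexed_iff_condIndepUnder {ι : Type*} {C : Finset ι} [IsProbabilityMeasure m]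
    (hX : Measurable X) (hY : Measurable Y) (hZ : Measurable Z)
    (hC : C = ∅ → ∃ z₀, ∀ᵐ ω ∂m, Z ω = z₀) :
    CondIndepIndexed C X Y Z m ↔ CondIndepUnder X Y Z m := by
  rcases C.eq_empty_or_nonempty with hempty | hne
  · obtain ⟨z₀, hz⟩ := hC hempty
    simp [CondIndepIndexed, hempty, condIndepUnder_iff_indepFun hX hz]
  · simp [CondIndepIndexed, hne, hne.ne_empty, condIndepGiven_iff_condIndepUnder hX hY hZ]

lemma condIndepIndexed_cond_iff {ι : Type*} {C : Finset ι} (hX : Measurable X)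
    (hY : Measurable Y) (hZ : Measurable Z) (hC : C = ∅ → ∃ z₀, ∀ ω, Z ω = z₀) {R : Set Ω}
    (pos : m R ≠ 0) (fin : m R ≠ ∞) :
    CondIndepIndexed C X Y Z (cond m R) ↔ CondIndepUnder X Y Z (m.restrict R) := by
  have := cond_isProbabilityMeasure_of_finite pos fin
  rw [condIndepIndexed_iff_condIndepUnder hX hY hZ fun h => (hC h).imp fun _ => .of_forall]
  refine ⟨fun h => ?_, fun h => h.smul _⟩
  have := h.smul (m R)
  rwa [ProbabilityTheory.cond, smul_smul, ENNReal.mul_inv_cancel pos fin, one_smul] at this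

end CondIndep

section RandomMeasure

variable {Ω α β γ : Type*} [MeasurableSpace Ω] [MeasurableSpace α] [MeasurableSpace β]
  [MeasurableSpace γ] {P : Measure Ω} [IsFiniteMeasure P] {ξ : Ω → Measure α}
  {η : Ω → Measure β} {ζ : Ω → γ}

lemma lintegral_indicator_mul_eq_of_condExp {G : Ω → ℝ≥0∞} {ψ a : γ → ℝ≥0∞} {s : Set (Measure α)}
    {u : Set γ} (hξ : Measurable ξ) (hζ : Measurable ζ) (hψ : Measurable ψ) (ha : Measurable a)
    (hs : MeasurableSet s) (hu : MeasurableSet u) (has : IsCondProb a (ξ ⁻¹' s) ζ P)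
    (h : ∀ (ρ : Measure α → ℝ≥0∞) (φ : γ → ℝ≥0∞), Measurable ρ → Measurable φ →
      ∫⁻ ω, φ (ζ ω) ∂P ≠ ∞ →
      ∫⁻ ω, G ω * φ (ζ ω) * ρ (ξ ω) ∂P = ∫⁻ ω, ψ (ζ ω) * φ (ζ ω) * ρ (ξ ω) ∂P) :
    ∫⁻ ω, (ξ ⁻¹' s ∩ ζ ⁻¹' u).indicator 1 ω * G ω ∂P =
      ∫⁻ ω, u.indicator a (ζ ω) * G ω ∂P := by
  have hu1 : Measurable (u.indicator 1 : γ → ℝ≥0∞) := measurable_one.indicator hu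
  have hau : ∫⁻ ω, u.indicator a (ζ ω) ∂P ≠ ∞ := by
    have := has u hu
    rw [← lintegral_indicator (hζ hu)] at this
    exact (this.symm.trans_lt (measure_lt_top _ _)).ne
  have hu1' : ∫⁻ ω, u.indicator 1 (ζ ω) ∂P ≠ ∞ := by
    have : ∫⁻ ω, u.indicator 1 (ζ ω) ∂P = P (ζ ⁻¹' u) := lintegral_indicator_one (hζ hu)
    exact this ▸ measure_ne_top _ _
  calc _ = ∫⁻ ω, G ω * u.indicator 1 (ζ ω) * s.indicator 1 (ξ ω) ∂P := by
        refine lintegral_congr fun ω => ?_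
        by_cases hω : ζ ω ∈ u <;> by_cases hω' : ξ ω ∈ s <;> simp [hω, hω']
    _ = ∫⁻ ω, ψ (ζ ω) * u.indicator 1 (ζ ω) * s.indicator 1 (ξ ω) ∂P :=
        h _ _ (measurable_one.indicator hs) hu1 hu1'
    _ = ∫⁻ ω in ξ ⁻¹' s, ψ (ζ ω) * u.indicator 1 (ζ ω) ∂P := by
        rw [← lintegral_indicator (hξ hs)]
        refine lintegral_congr fun ω => ?_
        by_cases hω' : ξ ω ∈ s <;> simp [hω']
    _ = ∫⁻ ω, a (ζ ω) * (ψ (ζ ω) * u.indicator 1 (ζ ω)) ∂P :=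
        has.setLIntegral_comp hζ ha (hψ.mul hu1)
    _ = ∫⁻ ω, ψ (ζ ω) * u.indicator a (ζ ω) * 1 ∂P := by
        refine lintegral_congr fun ω => ?_
        by_cases hω : ζ ω ∈ u <;> simp [hω, mul_comm]
    _ = ∫⁻ ω, G ω * u.indicator a (ζ ω) * 1 ∂P :=
        (h 1 _ measurable_one (ha.indicator hu) hau).symm
    _ = _ := lintegral_congr fun ω => by rw [mul_one, mul_comm]

lemma condIndepUnder_of_laplace (hξ : Measurable ξ) (hη : Measurable η) (hζ : Measurable ζ)
    {Ψ : (β → ℝ≥0∞) → γ → ℝ≥0∞} (hΨ : ∀ g, Measurable g → Measurable (Ψ g))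
    (h : ∀ f g (φ : γ → ℝ≥0∞), Measurable f → Measurable g → Measurable φ →
      ∫⁻ ω, expNeg (∫⁻ x, f x ∂ξ ω) * expNeg (∫⁻ y, g y ∂η ω) * φ (ζ ω) ∂P =
        ∫⁻ ω, expNeg (∫⁻ x, f x ∂ξ ω) * Ψ g (ζ ω) * φ (ζ ω) ∂P) :
    CondIndepUnder ξ η ζ P := by
  have hexp {g} (hg : Measurable g) : Measurable fun ω => expNeg (∫⁻ y, g y ∂η ω) :=
    measurable_expNeg.comp ((Measure.measurable_lintegral hg).comp hη)
  intro t ht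
  obtain ⟨b, hb, hbt⟩ := exists_isCondProb (m := P) hζ (η ⁻¹' t)
  refine ⟨b, hb, fun s hs => ?_⟩
  obtain ⟨a, ha, has⟩ := exists_isCondProb (m := P) hζ (ξ ⁻¹' s)
  refine (has.restrict_iff_mul (hξ hs) hζ ha hb).2 fun u hu => ?_
  have hξζ := (hξ hs).inter (hζ hu)
  -- The Laplace transforms of `ξ` and `η` are inverted one after the other, that of `ξ` first.
  have laplace_right {g} (hg : Measurable g) :
      ∫⁻ ω, (ξ ⁻¹' s ∩ ζ ⁻¹' u).indicator 1 ω * expNeg (∫⁻ y, g y ∂η ω) ∂P =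
        ∫⁻ ω, u.indicator a (ζ ω) * expNeg (∫⁻ y, g y ∂η ω) ∂P := by
    refine lintegral_indicator_mul_eq_of_condExp hξ hζ (hΨ g hg) ha hs hu has
      fun ρ φ hρ hφ fin => lintegral_mul_comp_eq_of_laplace hξ ((hexp hg).mul (hφ.comp hζ))
        (((hΨ g hg).comp hζ).mul (hφ.comp hζ)) ?_ (fun f hf => ?_) hρ
    · exact ((lintegral_mono fun ω => mul_le_of_le_one_left' (expNeg_le_one _)).trans_lt
        fin.lt_top).ne
    · simpa only [Pi.mul_apply, Function.comp_apply, mul_comm, mul_left_comm, mul_assoc] using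
        h f g φ hf hg hφ
  have ht1 : Measurable (t.indicator 1 : Measure β → ℝ≥0∞) := measurable_one.indicator ht
  have joint := lintegral_mul_comp_eq_of_laplace hη (measurable_one.indicator hξζ)
    ((ha.indicator hu).comp hζ) (by simp [lintegral_indicator_one hξζ])
    (fun g hg => laplace_right hg) ht1
  calc P (ξ ⁻¹' s ∩ η ⁻¹' t ∩ ζ ⁻¹' u)
      = ∫⁻ ω, (ξ ⁻¹' s ∩ ζ ⁻¹' u).indicator 1 ω * t.indicator 1 (η ω) ∂P := by
        rw [← lintegral_indicator_one (((hξ hs).inter (hη ht)).inter (hζ hu))]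
        refine lintegral_congr fun ω => ?_
        by_cases hω : η ω ∈ t <;> by_cases hω' : ξ ω ∈ s <;> by_cases hu' : ζ ω ∈ u <;>
          simp [hω, hω', hu']
    _ = ∫⁻ ω in η ⁻¹' t, u.indicator a (ζ ω) ∂P := by
        rw [joint, ← lintegral_indicator (hη ht)]
        refine lintegral_congr fun ω => ?_
        by_cases hω : η ω ∈ t <;> simp [hω]
    _ = ∫⁻ ω, b (ζ ω) * u.indicator a (ζ ω) ∂P := hbt.setLIntegral_comp hζ hb (ha.indicator hu)
    _ = ∫⁻ ω in ζ ⁻¹' u, a (ζ ω) * b (ζ ω) ∂P := by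
        rw [← lintegral_indicator (hζ hu)]
        refine lintegral_congr fun ω => ?_
        by_cases hω : ζ ω ∈ u <;> simp [hω, mul_comm]

end RandomMeasure

/-! ### Images of measures on punctured spaces -/

lemma CondIndepUnder.map_comp {S Ω α β γ α' β' γ' : Type*} [MeasurableSpace S]
    [MeasurableSpace Ω] [MeasurableSpace α] [MeasurableSpace β] [MeasurableSpace γ]
    [MeasurableSpace α'] [MeasurableSpace β'] [MeasurableSpace γ'] {P : Measure Ω}
    {ξ : Ω → Measure S} {X : S → α} {Y : S → β} {Z : S → γ} {f : α → α'} {g : β → β'} {k : γ → γ'}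
    {l : γ' → γ}
    (h : CondIndepUnder (fun ω => (ξ ω).map X) (fun ω => (ξ ω).map Y) (fun ω => (ξ ω).map Z) P)
    (hX : Measurable X) (hY : Measurable Y) (hZ : Measurable Z) (hf : Measurable f)
    (hg : Measurable g) (hk : Measurable k) (hl : Measurable l) (hlk : ∀ z, l (k z) = z) :
    CondIndepUnder (fun ω => (ξ ω).map fun x => f (X x)) (fun ω => (ξ ω).map fun x => g (Y x))
      (fun ω => (ξ ω).map fun x => k (Z x)) P := by
  refine h.recode (Measure.measurable_map _ hf) (Measure.measurable_map _ hg)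
    (Measure.measurable_map _ hk) (Measure.measurable_map _ hl)
    (.of_forall fun ω => (Measure.map_map hf hX).symm)
    (.of_forall fun ω => (Measure.map_map hg hY).symm)
    (.of_forall fun ω => (Measure.map_map hk hZ).symm) (.of_forall fun ω => ?_)
  exact (congrArg (ξ ω).map (funext fun x => (hlk (Z x)).symm)).trans
    (Measure.map_map hl (hk.comp hZ)).symm

section PuncturedMap

variable {S α β γ : Type*} [MeasurableSpace S] [MeasurableSpace α] [MeasurableSpace β]
  [MeasurableSpace γ]

/-- The image of `μ` under `Z` as a measure on the codomain with the point `z₀` removed. For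
`Z = coords o D` and `z₀ = D.restrict o` this is `marginal o μ D`. -/
noncomputable def puncturedMap (μ : Measure S) (Z : S → γ) (z₀ : γ) : Measure {z // z ≠ z₀} :=
  (μ.map Z).comap Subtype.val

lemma extend_val_base {γ : Type*} {z₀ : γ} (f : {z // z ≠ z₀} → ℝ≥0∞) :
    Function.extend Subtype.val f 0 z₀ = 0 :=
  Function.extend_apply' _ _ _ fun ⟨z, hz⟩ => z.2 hz

lemma extend_val_apply {γ : Type*} {z z₀ : γ} (f : {z // z ≠ z₀} → ℝ≥0∞) (hz : z ≠ z₀) :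
    Function.extend Subtype.val f 0 z = f ⟨z, hz⟩ :=
  Subtype.val_injective.extend_apply f 0 ⟨z, hz⟩

variable {μ : Measure S} {Z : S → γ} {z₀ : γ}

lemma measurable_map_val_add_smul_dirac (c : ℝ≥0∞) (z₀ : γ) :
    Measurable fun m : Measure {z // z ≠ z₀} => m.map Subtype.val + c • Measure.dirac z₀ :=
  (Measure.measurable_map _ measurable_subtype_coe).add_const _

variable [MeasurableSingletonClass γ]

lemma measurableEmbedding_ne_val (z₀ : γ) :
    MeasurableEmbedding (Subtype.val : {z // z ≠ z₀} → γ) :=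
  .subtype_coe (measurableSet_singleton z₀).compl

lemma puncturedMap_apply (hZ : Measurable Z) {G : Set {z // z ≠ z₀}} (hG : MeasurableSet G) :
    puncturedMap μ Z z₀ G = μ (Z ⁻¹' (Subtype.val '' G)) := by
  rw [puncturedMap, (measurableEmbedding_ne_val z₀).comap_apply,
    Measure.map_apply hZ ((measurableEmbedding_ne_val z₀).measurableSet_image' hG)]

lemma map_val_puncturedMap (μ : Measure S) (Z : S → γ) (z₀ : γ) :
    (puncturedMap μ Z z₀).map Subtype.val = (μ.map Z).restrict {z₀}ᶜ := by
  rw [puncturedMap, (measurableEmbedding_ne_val z₀).map_comap, Subtype.range_coe_subtype]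
  rfl

lemma puncturedMap_preimage_val (hZ : Measurable Z) {G : Set γ} (hG : MeasurableSet G) :
    puncturedMap μ Z z₀ (Subtype.val ⁻¹' G) = μ (Z ⁻¹' (G \ {z₀})) := by
  rw [puncturedMap_apply hZ (measurable_subtype_coe hG)]
  exact congrArg μ (congrArg _ ((Subtype.image_preimage_val _ G).trans (Set.inter_comm _ _)))

lemma measurable_extend_val {f : {z // z ≠ z₀} → ℝ≥0∞} (hf : Measurable f) :
    Measurable (Function.extend Subtype.val f 0) :=
  (measurableEmbedding_ne_val z₀).measurable_extend hf measurable_zero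

lemma lintegral_puncturedMap (hZ : Measurable Z) {f : {z // z ≠ z₀} → ℝ≥0∞} (hf : Measurable f) :
    ∫⁻ z, f z ∂puncturedMap μ Z z₀ = ∫⁻ x, Function.extend Subtype.val f 0 (Z x) ∂μ := by
  have hf' := measurable_extend_val hf
  calc ∫⁻ z, f z ∂puncturedMap μ Z z₀
      = ∫⁻ z, Function.extend Subtype.val f 0 z.1 ∂puncturedMap μ Z z₀ := by
        simp only [Subtype.val_injective.extend_apply]
    _ = ∫⁻ z in {z₀}ᶜ, Function.extend Subtype.val f 0 z ∂μ.map Z := by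
        rw [← map_val_puncturedMap, lintegral_map hf' measurable_subtype_coe]
    _ = ∫⁻ z, Function.extend Subtype.val f 0 z ∂μ.map Z := by
        rw [← lintegral_indicator (measurableSet_singleton z₀).compl]
        refine lintegral_congr fun z => ?_
        by_cases hz : z = z₀ <;> simp [hz]
    _ = _ := lintegral_map hf' hZ

lemma ae_puncturedMap_iff (hZ : Measurable Z) {p : {z // z ≠ z₀} → Prop}
    (hp : MeasurableSet {z | p z}) :
    (∀ᵐ z ∂puncturedMap μ Z z₀, p z) ↔ ∀ᵐ x ∂μ, ∀ h : Z x ≠ z₀, p ⟨Z x, h⟩ := by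
  have h := puncturedMap_apply (μ := μ) hZ hp.compl
  rw [ae_iff, ae_iff, ← Set.compl_ofPred, h]
  refine Eq.congr (congrArg μ (Set.ext fun x => ?_)) rfl
  simp

lemma measurable_puncturedMap (hZ : Measurable Z) :
    Measurable fun μ : Measure S => puncturedMap μ Z z₀ :=
  Measure.measurable_of_measurable_coe _ fun G hG => by
    simp_rw [puncturedMap_apply hZ hG]
    exact Measure.measurable_coe (hZ ((measurableEmbedding_ne_val z₀).measurableSet_image' hG))

lemma puncturedMap_puncturedMap [MeasurableSingletonClass α] (hZ : Measurable Z) {w : γ → α}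
    (hw : Measurable w) :
    puncturedMap (puncturedMap μ Z z₀) (fun z => w z) (w z₀) =
      puncturedMap μ (fun x => w (Z x)) (w z₀) := by
  ext G hG
  have hG' := (measurableEmbedding_ne_val (w z₀)).measurableSet_image' hG
  have left := puncturedMap_apply (μ := puncturedMap μ Z z₀)
    (hw.comp (measurable_subtype_coe (p := (· ≠ z₀)))) hG
  refine left.trans (Eq.trans ?_ (puncturedMap_apply (hw.comp hZ) hG).symm)
  refine (puncturedMap_preimage_val hZ (hw hG')).trans (congrArg μ (Set.ext fun x => ?_))
  refine ⟨fun hx => hx.1, fun hx => ⟨hx, fun hx' => ?_⟩⟩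
  obtain ⟨z, -, hz⟩ := hx
  exact z.2 (hz.trans (congrArg w hx'))

lemma IsPointMeasure.punctured (h : IsPointMeasure μ) (hZ : Measurable Z) :
    IsPointMeasure (puncturedMap μ Z z₀) := by
  have := h.1
  refine ⟨⟨fun n => puncturedMap (sfiniteSeq μ n) Z z₀, fun n => ⟨?_⟩, ?_⟩,
    fun G hG => ?_⟩
  · rw [puncturedMap_apply hZ .univ]
    exact measure_lt_top _ _
  · ext G hG
    have hG' := hZ ((measurableEmbedding_ne_val z₀).measurableSet_image' hG)
    simp_rw [Measure.sum_apply _ hG, puncturedMap_apply hZ hG]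
    rw [← Measure.sum_apply _ hG', sum_sfiniteSeq]
  · rw [puncturedMap_apply hZ hG]
    exact h.2 _ (hZ ((measurableEmbedding_ne_val z₀).measurableSet_image' hG))

variable {Ω : Type*} [MeasurableSpace Ω] {P : Measure Ω} {ξ : Ω → Measure S} {Λ : Measure S}

namespace IsPoissonProcess

lemma punctured (hξ : IsPoissonProcess ξ Λ P) (hZ : Measurable Z) :
    IsPoissonProcess (fun ω => puncturedMap (ξ ω) Z z₀) (puncturedMap Λ Z z₀) P := by
  have hpre {G : Set {z // z ≠ z₀}} (hG : MeasurableSet G) :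
      MeasurableSet (Z ⁻¹' (Subtype.val '' G)) :=
    hZ ((measurableEmbedding_ne_val z₀).measurableSet_image' hG)
  refine ⟨(measurable_puncturedMap hZ).comp hξ.measurable,
    fun ω => (hξ.isPointMeasure ω).punctured hZ, fun G hG fin => ?_, fun G hG top => ?_,
    fun m G hG disj => ?_⟩
  · simp_rw [puncturedMap_apply hZ hG] at fin ⊢
    exact hξ.law_of_finite _ (hpre hG) fin
  · simp_rw [puncturedMap_apply hZ hG] at top ⊢
    exact hξ.law_of_infinite _ (hpre hG) top
  · simp_rw [puncturedMap_apply hZ (hG _)]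
    exact hξ.indep m _ (fun i => hpre (hG i)) fun i j hij =>
      ((Set.disjoint_image_iff Subtype.val_injective).2 (disj hij)).preimage Z

lemma ae_apply_eq [IsProbabilityMeasure P] (hξ : IsPoissonProcess ξ Λ P) {G : Set S}
    (hG : MeasurableSet G) (h : Λ G = 0 ∨ Λ G = ∞) : ∀ᵐ ω ∂P, ξ ω G = Λ G := by
  rcases h with h | h <;> rw [h]
  · have total := hξ.lintegral_expNeg_mul 1 hG
    simp_rw [h, mul_zero, one_mul, expNeg_zero] at total
    have := ae_eq_of_ae_le_of_lintegral_le (μ := P) (f := fun ω => expNeg (ξ ω G))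
      (g := 1) (.of_forall fun ω => expNeg_le_one _) (by simp [total]) aemeasurable_const
      (by simp [total])
    filter_upwards [this] with ω hω
    exact expNeg_injective (hω.trans expNeg_zero.symm)
  · exact hξ.law_of_infinite G hG h

lemma ae_ae (hξ : IsPoissonProcess ξ Λ P) [IsProbabilityMeasure P] {p : S → Prop}
    (hp : ∀ᵐ x ∂Λ, p x) : ∀ᵐ ω ∂P, ∀ᵐ x ∂ξ ω, p x := by
  obtain ⟨N, hpN, hN, hN0⟩ := exists_measurable_superset_of_null (ae_iff.1 hp)
  filter_upwards [hξ.ae_apply_eq hN (.inl hN0)] with ω hω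
  exact ae_iff.2 (measure_mono_null hpN (hω.trans hN0))

lemma ae_map_eq [IsProbabilityMeasure P] (hξ : IsPoissonProcess ξ Λ P) (hZ : Measurable Z)
    (h : Λ (Z ⁻¹' {z₀}) = 0 ∨ Λ (Z ⁻¹' {z₀}) = ∞) :
    ∀ᵐ ω ∂P, (ξ ω).map Z = (puncturedMap (ξ ω) Z z₀).map Subtype.val +
      Λ (Z ⁻¹' {z₀}) • Measure.dirac z₀ := by
  filter_upwards [hξ.ae_apply_eq (hZ (measurableSet_singleton z₀)) h] with ω hω
  rw [map_val_puncturedMap, ← hω, ← Measure.map_apply hZ (measurableSet_singleton z₀),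
    ← Measure.restrict_singleton, add_comm,
    Measure.restrict_add_restrict_compl (measurableSet_singleton z₀)]

lemma condIndepUnder_map_iff_puncturedMap [MeasurableSingletonClass α]
    [MeasurableSingletonClass β] [IsProbabilityMeasure P] (hξ : IsPoissonProcess ξ Λ P)
    {X : S → α} {Y : S → β} {x₀ : α} {y₀ : β} (hX : Measurable X) (hY : Measurable Y)
    (hZ : Measurable Z) (hx : Λ (X ⁻¹' {x₀}) = 0 ∨ Λ (X ⁻¹' {x₀}) = ∞)
    (hy : Λ (Y ⁻¹' {y₀}) = 0 ∨ Λ (Y ⁻¹' {y₀}) = ∞)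
    (hz : Λ (Z ⁻¹' {z₀}) = 0 ∨ Λ (Z ⁻¹' {z₀}) = ∞) :
    CondIndepUnder (fun ω => (ξ ω).map X) (fun ω => (ξ ω).map Y) (fun ω => (ξ ω).map Z) P ↔
      CondIndepUnder (fun ω => puncturedMap (ξ ω) X x₀) (fun ω => puncturedMap (ξ ω) Y y₀)
        (fun ω => puncturedMap (ξ ω) Z z₀) P := by
  have ae_eq_X := hξ.ae_map_eq hX hx
  have ae_eq_Y := hξ.ae_map_eq hY hy
  have ae_eq_Z := hξ.ae_map_eq hZ hz
  constructor
  · refine fun h => h.recode (measurable_puncturedMap measurable_id)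
      (measurable_puncturedMap measurable_id) (measurable_puncturedMap measurable_id)
      (measurable_map_val_add_smul_dirac _ z₀) ?_ ?_ ?_ ae_eq_Z
    all_goals exact .of_forall fun ω => by simp [puncturedMap]
  · exact fun h => h.recode (measurable_map_val_add_smul_dirac _ x₀)
      (measurable_map_val_add_smul_dirac _ y₀) (measurable_map_val_add_smul_dirac _ z₀)
      (measurable_puncturedMap measurable_id) ae_eq_X ae_eq_Y ae_eq_Z
      (.of_forall fun ω => by simp [puncturedMap])

end IsPoissonProcess

end PuncturedMap

/-! ### Disintegration over a punctured space -/

lemma lintegral_div_withDensity {γ : Type*} [MeasurableSpace γ] (μ : Measure γ)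
    {g φ : γ → ℝ≥0∞} (hg : Measurable g) (hφ : Measurable φ) (h0 : ∀ z, g z ≠ 0)
    (htop : ∀ z, g z ≠ ∞) : ∫⁻ z, φ z / g z ∂μ.withDensity g = ∫⁻ z, φ z ∂μ :=
  (lintegral_withDensity_eq_lintegral_mul μ hg (hφ.div hg)).trans <|
    lintegral_congr fun z => ENNReal.mul_div_cancel (h0 z) (htop z)

/-- `ρ.condKernel` is only available for finite `ρ`; here the mass of the fibres is first made
finite by a density that depends on the first coordinate. -/
lemma exists_compProd_fst_eq {γ δ : Type*} [MeasurableSpace γ] [MeasurableSpace δ]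
    [StandardBorelSpace δ] [Nonempty δ] (ρ : Measure (γ × δ)) [SigmaFinite ρ.fst] :
    ∃ κ : Kernel γ δ, IsMarkovKernel κ ∧ ρ.fst ⊗ₘ κ = ρ := by
  obtain ⟨g, g_pos, hg, g_lt⟩ := exists_pos_lintegral_lt_of_sigmaFinite ρ.fst one_ne_zero
  have hg : Measurable fun z => (g z : ℝ≥0∞) := hg.coe_nnreal_ennreal
  have g_ne_zero (z : γ) : (g z : ℝ≥0∞) ≠ 0 := ENNReal.coe_ne_zero.2 (g_pos z).ne'
  have hgp : Measurable fun p : γ × δ => (g p.1 : ℝ≥0∞) := hg.comp measurable_fst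
  set ρ' := ρ.withDensity fun p => (g p.1 : ℝ≥0∞)
  have fst_eq : ρ'.fst = ρ.fst.withDensity fun z => (g z : ℝ≥0∞) := by
    ext u hu
    rw [Measure.fst_apply hu, withDensity_apply _ (measurable_fst hu), withDensity_apply _ hu,
      Measure.fst, setLIntegral_map hu hg measurable_fst]
  have : IsFiniteMeasure ρ' := by
    refine isFiniteMeasure_withDensity ?_
    rw [Measure.fst, lintegral_map hg measurable_fst] at g_lt
    exact (g_lt.trans ENNReal.one_lt_top).ne
  refine ⟨ρ'.condKernel, inferInstance, Measure.ext fun G hG => ?_⟩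
  have hκ : Measurable fun z => ρ'.condKernel z (Prod.mk z ⁻¹' G) :=
    Kernel.measurable_kernel_prodMk_left hG
  have hG' : Measurable fun p : γ × δ => G.indicator 1 p / (g p.1 : ℝ≥0∞) :=
    (measurable_one.indicator hG).div hgp
  calc (ρ.fst ⊗ₘ ρ'.condKernel) G
      = ∫⁻ z, ρ'.condKernel z (Prod.mk z ⁻¹' G) ∂ρ.fst := Measure.compProd_apply hG
    _ = ∫⁻ z, ρ'.condKernel z (Prod.mk z ⁻¹' G) / g z ∂ρ'.fst := by
        rw [fst_eq, lintegral_div_withDensity _ hg hκ g_ne_zero fun _ => ENNReal.coe_ne_top]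
    _ = ∫⁻ p, G.indicator 1 p / g p.1 ∂(ρ'.fst ⊗ₘ ρ'.condKernel) := by
        rw [Measure.lintegral_compProd hG']
        refine lintegral_congr fun z => ?_
        simp_rw [div_eq_mul_inv]
        rw [lintegral_mul_const' _ _ (ENNReal.inv_ne_top.2 (g_ne_zero z))]
        exact congrArg (· * _) (lintegral_indicator_one (measurable_prodMk_left hG)).symm
    _ = ∫⁻ p, G.indicator 1 p ∂ρ := by
        rw [ρ'.disintegrate ρ'.condKernel]
        exact lintegral_div_withDensity ρ hgp (measurable_one.indicator hG)
          (fun p => g_ne_zero p.1) fun _ => ENNReal.coe_ne_top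
    _ = ρ G := lintegral_indicator_one hG

section Disintegration

variable {S γ δ : Type*} [MeasurableSpace S] [MeasurableSpace γ] [MeasurableSpace δ]
  {Λ : Measure S} {Z : S → γ} {z₀ : γ} {W : S → δ}

/-- The joint law of `Z` and `W` under `Λ` on the event `{Z ≠ z₀}`. -/
noncomputable def puncturedJoint (Λ : Measure S) (Z : S → γ) (z₀ : γ) (W : S → δ) :
    Measure ({z // z ≠ z₀} × δ) :=
  (Λ.comap Subtype.val).map fun x : {x // Z x ≠ z₀} => (⟨Z x, x.2⟩, W x)

/-- The kernel `κ` disintegrates the joint law of `Z` and `W` under `Λ` on `{Z ≠ z₀}`. For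
`Z = coords o C` and `W` the pair of `coords o A` and `coords o B`, this is `IsDisintegration`
without the condition that `κ` is a probability kernel. -/
def Disintegrates (Λ : Measure S) (Z : S → γ) (z₀ : γ) (W : S → δ)
    (κ : Kernel {z // z ≠ z₀} δ) : Prop :=
  ∀ G : Set ({z // z ≠ z₀} × δ), MeasurableSet G →
    Λ {x | ∃ hx : Z x ≠ z₀, (⟨Z x, hx⟩, W x) ∈ G} =
      ∫⁻ z, κ z {w | (z, w) ∈ G} ∂puncturedMap Λ Z z₀

lemma measurable_punctured_pair (hZ : Measurable Z) (hW : Measurable W) :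
    Measurable fun x : {x // Z x ≠ z₀} => ((⟨Z x, x.2⟩ : {z // z ≠ z₀}), W x) :=
  (hZ.comp measurable_subtype_coe).subtype_mk.prodMk (hW.comp measurable_subtype_coe)

variable [MeasurableSingletonClass γ]

lemma measurableSet_ne (hZ : Measurable Z) (z₀ : γ) : MeasurableSet {x | Z x ≠ z₀} :=
  hZ (measurableSet_singleton z₀).compl

lemma puncturedJoint_apply (hZ : Measurable Z) (hW : Measurable W)
    {G : Set ({z // z ≠ z₀} × δ)} (hG : MeasurableSet G) :
    puncturedJoint Λ Z z₀ W G = Λ {x | ∃ hx : Z x ≠ z₀, (⟨Z x, hx⟩, W x) ∈ G} := by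
  rw [puncturedJoint, Measure.map_apply (measurable_punctured_pair hZ hW) hG]
  refine ((MeasurableEmbedding.subtype_coe (measurableSet_ne hZ z₀)).comap_apply Λ _).trans ?_
  congr 1
  ext x
  simp

lemma puncturedJoint_fst (hZ : Measurable Z) (hW : Measurable W) :
    (puncturedJoint Λ Z z₀ W).fst = puncturedMap Λ Z z₀ := by
  ext u hu
  rw [Measure.fst_apply hu, puncturedJoint_apply hZ hW (measurable_fst hu),
    puncturedMap_apply hZ hu]
  congr 1
  ext x
  simp

lemma exists_disintegrates [StandardBorelSpace δ] [Nonempty δ] [SigmaFinite (puncturedMap Λ Z z₀)]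
    (hZ : Measurable Z) (hW : Measurable W) :
    ∃ κ : Kernel {z // z ≠ z₀} δ, IsMarkovKernel κ ∧ Disintegrates Λ Z z₀ W κ := by
  have fst_eq := puncturedJoint_fst (Λ := Λ) (z₀ := z₀) hZ hW
  have : SigmaFinite (puncturedJoint Λ Z z₀ W).fst := fst_eq ▸ ‹_›
  obtain ⟨κ, hκ, h⟩ := exists_compProd_fst_eq (puncturedJoint Λ Z z₀ W)
  refine ⟨κ, hκ, fun G hG => ?_⟩
  rw [← puncturedJoint_apply hZ hW hG, ← fst_eq]
  nth_rw 1 [← h]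
  exact Measure.compProd_apply hG

variable {κ : Kernel {z // z ≠ z₀} δ} [IsSFiniteKernel κ]

lemma Disintegrates.lintegral_eq [SFinite (puncturedMap Λ Z z₀)] (h : Disintegrates Λ Z z₀ W κ)
    (hZ : Measurable Z) (hW : Measurable W) {Φ : γ × δ → ℝ≥0∞} (hΦ : Measurable Φ) :
    ∫⁻ x in {x | Z x ≠ z₀}, Φ (Z x, W x) ∂Λ =
      ∫⁻ z, ∫⁻ w, Φ (z, w) ∂κ z ∂puncturedMap Λ Z z₀ := by
  have joint_eq : puncturedJoint Λ Z z₀ W = puncturedMap Λ Z z₀ ⊗ₘ κ := by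
    ext G hG
    rw [puncturedJoint_apply hZ hW hG, Measure.compProd_apply hG, h G hG]
    rfl
  have hΦ' : Measurable fun p : {z // z ≠ z₀} × δ => Φ (p.1, p.2) :=
    hΦ.comp (measurable_subtype_coe.prodMap measurable_id)
  rw [← lintegral_subtype_comap (measurableSet_ne hZ z₀)]
  calc _ = ∫⁻ p, Φ (p.1, p.2) ∂puncturedJoint Λ Z z₀ W :=
        (lintegral_map hΦ' (measurable_punctured_pair hZ hW)).symm
    _ = _ := by rw [joint_eq, Measure.lintegral_compProd hΦ']

end Disintegration

/-! ### Conditional independence of projections of a Poisson process -/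

lemma expNeg_lintegral_mul_expNeg_lintegral {S : Type*} [MeasurableSpace S] (μ : Measure S)
    {u : S → ℝ≥0∞} (hu : Measurable u) (v : S → ℝ≥0∞) :
    expNeg (∫⁻ x, u x ∂μ) * expNeg (∫⁻ x, v x ∂μ) = expNeg (∫⁻ x, u x + v x ∂μ) := by
  rw [← expNeg_add, lintegral_add_left hu]

section CondLaplace

variable {Ω S γ δ : Type*} [MeasurableSpace Ω] [MeasurableSpace S] [MeasurableSpace γ]
  [MeasurableSpace δ] {Λ : Measure S} {Z : S → γ} {z₀ : γ} {W : S → δ}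
  {κ : Kernel {z // z ≠ z₀} δ} {v v₁ v₂ : δ → ℝ≥0∞}

/-- The conditional Laplace functional at `v ∘ W` of a Poisson process with mean measure `Λ`, given
that its image under `Z` off `z₀` is `m`: the points with `Z ≠ z₀` carry independent marks `W` with
distributions `κ`, and the points with `Z = z₀` are independent of them. -/
noncomputable def condLaplace (Λ : Measure S) (Z : S → γ) (z₀ : γ) (W : S → δ)
    (κ : Kernel {z // z ≠ z₀} δ) (v : δ → ℝ≥0∞) (m : Measure {z // z ≠ z₀}) : ℝ≥0∞ :=
  expNeg (∫⁻ x in Z ⁻¹' {z₀}, (1 - expNeg (v (W x))) ∂Λ) *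
    expNeg (∫⁻ z, negLog (∫⁻ w, expNeg (v w) ∂κ z) ∂m)

lemma measurable_lintegral_expNeg_kernel (κ : Kernel γ δ) (hv : Measurable v) :
    Measurable fun z => ∫⁻ w, expNeg (v w) ∂κ z :=
  (measurable_expNeg.comp hv).lintegral_kernel

lemma lintegral_expNeg_le_one (κ : Kernel γ δ) [IsMarkovKernel κ] (v : δ → ℝ≥0∞) (z : γ) :
    ∫⁻ w, expNeg (v w) ∂κ z ≤ 1 :=
  (lintegral_mono fun w => expNeg_le_one (v w)).trans (by simp)

lemma measurable_condLaplace (hv : Measurable v) : Measurable (condLaplace Λ Z z₀ W κ v) :=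
  (measurable_expNeg.comp (Measure.measurable_lintegral
    (measurable_negLog.comp (measurable_lintegral_expNeg_kernel κ hv)))).const_mul _

lemma condLaplace_add [IsMarkovKernel κ] {m : Measure {z // z ≠ z₀}} (hv₁ : Measurable v₁)
    (off : ∫⁻ x in Z ⁻¹' {z₀}, (1 - expNeg (v₁ (W x) + v₂ (W x))) ∂Λ =
      ∫⁻ x in Z ⁻¹' {z₀}, (1 - expNeg (v₁ (W x))) ∂Λ +
        ∫⁻ x in Z ⁻¹' {z₀}, (1 - expNeg (v₂ (W x))) ∂Λ)
    (fibre : ∀ᵐ z ∂m, ∫⁻ w, expNeg (v₁ w + v₂ w) ∂κ z =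
      (∫⁻ w, expNeg (v₁ w) ∂κ z) * ∫⁻ w, expNeg (v₂ w) ∂κ z) :
    condLaplace Λ Z z₀ W κ (fun w => v₁ w + v₂ w) m =
      condLaplace Λ Z z₀ W κ v₁ m * condLaplace Λ Z z₀ W κ v₂ m := by
  have log_add : ∫⁻ z, negLog (∫⁻ w, expNeg (v₁ w + v₂ w) ∂κ z) ∂m =
      ∫⁻ z, (negLog (∫⁻ w, expNeg (v₁ w) ∂κ z) + negLog (∫⁻ w, expNeg (v₂ w) ∂κ z)) ∂m := by
    refine lintegral_congr_ae ?_
    filter_upwards [fibre] with z hz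
    rw [hz, negLog_mul (lintegral_expNeg_le_one κ _ z) (lintegral_expNeg_le_one κ _ z)]
  have hlog : Measurable fun z => negLog (∫⁻ w, expNeg (v₁ w) ∂κ z) :=
    measurable_negLog.comp (measurable_lintegral_expNeg_kernel κ hv₁)
  rw [condLaplace, off, log_add, expNeg_add, condLaplace, condLaplace, mul_mul_mul_comm,
    expNeg_lintegral_mul_expNeg_lintegral m hlog]

variable [MeasurableSingletonClass γ] [SFinite (puncturedMap Λ Z z₀)] [IsMarkovKernel κ]

namespace Disintegrates

lemma lintegral_one_sub_expNeg (hκ : Disintegrates Λ Z z₀ W κ) (hZ : Measurable Z)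
    (hW : Measurable W) (hv : Measurable v) {f : {z // z ≠ z₀} → ℝ≥0∞} (hf : Measurable f) :
    ∫⁻ x, (1 - expNeg (v (W x) + Function.extend Subtype.val f 0 (Z x))) ∂Λ =
      ∫⁻ x in Z ⁻¹' {z₀}, (1 - expNeg (v (W x))) ∂Λ +
        ∫⁻ z, (1 - (∫⁻ w, expNeg (v w) ∂κ z) * expNeg (f z)) ∂puncturedMap Λ Z z₀ := by
  have hf' := measurable_extend_val hf
  have on : ∫⁻ x in Z ⁻¹' {z₀}, (1 - expNeg (v (W x) + Function.extend Subtype.val f 0 (Z x))) ∂Λ =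
      ∫⁻ x in Z ⁻¹' {z₀}, (1 - expNeg (v (W x))) ∂Λ := by
    refine setLIntegral_congr_fun (hZ (measurableSet_singleton z₀)) fun x hx => ?_
    rw [Set.mem_preimage, Set.mem_singleton_iff] at hx
    simp only [hx, extend_val_base, add_zero]
  have off : ∫⁻ x in (Z ⁻¹' {z₀})ᶜ,
        (1 - expNeg (v (W x) + Function.extend Subtype.val f 0 (Z x))) ∂Λ =
      ∫⁻ z, (1 - (∫⁻ w, expNeg (v w) ∂κ z) * expNeg (f z)) ∂puncturedMap Λ Z z₀ := by
    refine (hκ.lintegral_eq hZ hW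
      (Φ := fun p => 1 - expNeg (v p.2 + Function.extend Subtype.val f 0 p.1)) ?_).trans
      (lintegral_congr fun z => ?_)
    · exact measurable_const.sub (measurable_expNeg.comp
        ((hv.comp measurable_snd).add (hf'.comp measurable_fst)))
    have hexp : Measurable fun w => expNeg (v w) := measurable_expNeg.comp hv
    have ne_top : ∫⁻ w, expNeg (v w) * expNeg (f z) ∂κ z ≠ ∞ := by
      rw [lintegral_mul_const _ hexp]
      exact ENNReal.mul_ne_top (ne_top_of_le_ne_top ENNReal.one_ne_top
        (lintegral_expNeg_le_one κ v z)) (expNeg_ne_top _)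
    simp only [Subtype.val_injective.extend_apply, expNeg_add]
    rw [lintegral_sub (hexp.mul_const _) ne_top
        (.of_forall fun w => mul_le_one' (expNeg_le_one _) (expNeg_le_one _)),
      lintegral_mul_const _ hexp, lintegral_one, measure_univ]
  rw [← lintegral_add_compl _ (hZ (measurableSet_singleton z₀)), on, off]

end Disintegrates

variable {P : Measure Ω} [IsProbabilityMeasure P] {ξ : Ω → Measure S}

namespace IsPoissonProcess

lemma lintegral_expNeg_mul_expNeg_puncturedMap (hξ : IsPoissonProcess ξ Λ P)
    (hκ : Disintegrates Λ Z z₀ W κ) (hZ : Measurable Z) (hW : Measurable W) (hv : Measurable v)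
    {f : {z // z ≠ z₀} → ℝ≥0∞} (hf : Measurable f) :
    ∫⁻ ω, expNeg (∫⁻ x, v (W x) ∂ξ ω) * expNeg (∫⁻ z, f z ∂puncturedMap (ξ ω) Z z₀) ∂P =
      expNeg (∫⁻ x in Z ⁻¹' {z₀}, (1 - expNeg (v (W x))) ∂Λ +
        ∫⁻ z, (1 - (∫⁻ w, expNeg (v w) ∂κ z) * expNeg (f z)) ∂puncturedMap Λ Z z₀) := by
  have hf' := (measurable_extend_val hf).comp hZ
  simp_rw [lintegral_puncturedMap hZ hf]
  refine (lintegral_congr fun ω => expNeg_lintegral_mul_expNeg_lintegral (ξ ω) (hv.comp hW) _).trans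
    ?_
  exact (hξ.lintegral_expNeg_lintegral ((hv.comp hW).add hf')).trans
    (congrArg expNeg (hκ.lintegral_one_sub_expNeg hZ hW hv hf))

lemma lintegral_expNeg_negLog_mul_expNeg (hξ : IsPoissonProcess ξ Λ P) {q f : S → ℝ≥0∞}
    (hq : Measurable q) (hq1 : ∀ x, q x ≤ 1) (hf : Measurable f) :
    ∫⁻ ω, expNeg (∫⁻ x, negLog (q x) ∂ξ ω) * expNeg (∫⁻ x, f x ∂ξ ω) ∂P =
      expNeg (∫⁻ x, (1 - q x * expNeg (f x)) ∂Λ) := by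
  have hlog : Measurable fun x => negLog (q x) := measurable_negLog.comp hq
  simp_rw [expNeg_lintegral_mul_expNeg_lintegral _ hlog]
  refine (hξ.lintegral_expNeg_lintegral (hlog.add hf)).trans ?_
  simp only [Pi.add_apply, expNeg_add, expNeg_negLog (hq1 _)]

lemma lintegral_expNeg_mul_comp_puncturedMap (hξ : IsPoissonProcess ξ Λ P)
    (hκ : Disintegrates Λ Z z₀ W κ) (hZ : Measurable Z) (hW : Measurable W) (hv : Measurable v)
    {φ : Measure {z // z ≠ z₀} → ℝ≥0∞} (hφ : Measurable φ) :
    ∫⁻ ω, expNeg (∫⁻ x, v (W x) ∂ξ ω) * φ (puncturedMap (ξ ω) Z z₀) ∂P =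
      ∫⁻ ω, condLaplace Λ Z z₀ W κ v (puncturedMap (ξ ω) Z z₀) *
        φ (puncturedMap (ξ ω) Z z₀) ∂P := by
  have hζ := hξ.punctured hZ (z₀ := z₀)
  have hexp : Measurable fun ω => expNeg (∫⁻ x, v (W x) ∂ξ ω) :=
    measurable_expNeg.comp ((Measure.measurable_lintegral (hv.comp hW)).comp hξ.measurable)
  refine lintegral_mul_comp_eq_of_laplace hζ.measurable hexp
    ((measurable_condLaplace hv).comp hζ.measurable) ?_ (fun f hf => ?_) hφ
  · exact ((lintegral_mono fun ω => expNeg_le_one _).trans_lt (by simp)).ne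
  have hq := measurable_lintegral_expNeg_kernel κ hv
  rw [hξ.lintegral_expNeg_mul_expNeg_puncturedMap hκ hZ hW hv hf, expNeg_add,
    ← hζ.lintegral_expNeg_negLog_mul_expNeg hq (lintegral_expNeg_le_one κ v) hf,
    ← lintegral_const_mul' _ _ (expNeg_ne_top _)]
  exact lintegral_congr fun ω => (mul_assoc _ _ _).symm

lemma isCondProb_condLaplace_indicator_top (hξ : IsPoissonProcess ξ Λ P)
    (hκ : Disintegrates Λ Z z₀ W κ) (hZ : Measurable Z) (hW : Measurable W) {r : Set δ}
    (hr : MeasurableSet r) :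
    IsCondProb (condLaplace Λ Z z₀ W κ (r.indicator ⊤)) {ω | ξ ω (W ⁻¹' r) = 0}
      (fun ω => puncturedMap (ξ ω) Z z₀) P := by
  intro u hu
  have hζ : Measurable fun ω => puncturedMap (ξ ω) Z z₀ := (hξ.punctured hZ).measurable
  have void : MeasurableSet {ω | ξ ω (W ⁻¹' r) = 0} :=
    hξ.measurable_apply (hW hr) (measurableSet_singleton 0)
  have key := hξ.lintegral_expNeg_mul_comp_puncturedMap hκ hZ hW
    ((measurable_const (a := ∞)).indicator hr) (measurable_one.indicator hu)
  rw [← lintegral_indicator_one (void.inter (hζ hu)), ← lintegral_indicator (hζ hu)]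
  refine (lintegral_congr fun ω => ?_).trans (key.trans (lintegral_congr fun ω => ?_))
  · have : ∫⁻ x, r.indicator (fun _ => ∞) (W x) ∂ξ ω = ∞ * ξ ω (W ⁻¹' r) :=
      lintegral_indicator_const (hW hr) ∞
    rw [this]
    by_cases hω : ξ ω (W ⁻¹' r) = 0 <;> by_cases hu' : puncturedMap (ξ ω) Z z₀ ∈ u <;>
      simp [hω, hu', expNeg_zero, expNeg_top]
  · by_cases hu' : puncturedMap (ξ ω) Z z₀ ∈ u <;> simp [hu', Pi.top_def]

end IsPoissonProcess

end CondLaplace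

section PoissonCondIndep

variable {Ω S α β γ : Type*} [MeasurableSpace Ω] [MeasurableSpace S] [MeasurableSpace γ]
  {Λ : Measure S} {X : S → α} {Y : S → β} {Z : S → γ} {x₀ : α} {y₀ : β} {z₀ : γ}

lemma lintegral_one_sub_expNeg_add_of_null (hZ : Measurable Z) [MeasurableSingletonClass γ]
    (null : Λ {x | X x ≠ x₀ ∧ Y x ≠ y₀ ∧ Z x = z₀} = 0) {f : α → ℝ≥0∞} {g : β → ℝ≥0∞}
    (hfX : Measurable fun x => f (X x)) (hf : f x₀ = 0) (hg : g y₀ = 0) :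
    ∫⁻ x in Z ⁻¹' {z₀}, (1 - expNeg (f (X x) + g (Y x))) ∂Λ =
      ∫⁻ x in Z ⁻¹' {z₀}, (1 - expNeg (f (X x))) ∂Λ +
        ∫⁻ x in Z ⁻¹' {z₀}, (1 - expNeg (g (Y x))) ∂Λ := by
  have hef : Measurable fun x => 1 - expNeg (f (X x)) :=
    measurable_const.sub (measurable_expNeg.comp hfX)
  rw [← lintegral_add_left hef]
  refine lintegral_congr_ae ((ae_restrict_iff' (hZ (measurableSet_singleton z₀))).2 ?_)
  have : ∀ᵐ x ∂Λ, ¬(X x ≠ x₀ ∧ Y x ≠ y₀ ∧ Z x = z₀) := measure_eq_zero_iff_ae_notMem.1 null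
  filter_upwards [this] with x hx hxz
  have : X x = x₀ ∨ Y x = y₀ := by
    by_contra! h
    exact hx ⟨h.1, h.2, hxz⟩
  rcases this with h | h <;> simp [h, hf, hg, expNeg_zero]

variable [MeasurableSpace α] [MeasurableSpace β]

lemma lintegral_expNeg_add_of_eq_prod {κ : Kernel γ (α × β)} [IsSFiniteKernel κ] {z : γ}
    (hz : κ z = (κ.fst z).prod (κ.snd z)) {f : α → ℝ≥0∞} {g : β → ℝ≥0∞} (hf : Measurable f)
    (hg : Measurable g) :
    ∫⁻ w, expNeg (f w.1 + g w.2) ∂κ z =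
      (∫⁻ w, expNeg (f w.1) ∂κ z) * ∫⁻ w, expNeg (g w.2) ∂κ z := by
  have hef : Measurable fun x => expNeg (f x) := measurable_expNeg.comp hf
  have heg : Measurable fun y => expNeg (g y) := measurable_expNeg.comp hg
  rw [← Kernel.lintegral_fst _ _ hef, ← Kernel.lintegral_snd _ _ heg, hz]
  simp only [expNeg_add]
  exact lintegral_prod_mul hef.aemeasurable heg.aemeasurable

variable [MeasurableSingletonClass γ] {κ : Kernel {z // z ≠ z₀} (α × β)} [IsMarkovKernel κ]
  {P : Measure Ω} [IsProbabilityMeasure P] {ξ : Ω → Measure S}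

namespace IsPoissonProcess

lemma lintegral_expNeg_mul_condLaplace [SFinite (puncturedMap Λ Z z₀)]
    (hξ : IsPoissonProcess ξ Λ P) (hX : Measurable X) (hY : Measurable Y) (hZ : Measurable Z)
    (hκ : Disintegrates Λ Z z₀ (fun x => (X x, Y x)) κ)
    (null : Λ {x | X x ≠ x₀ ∧ Y x ≠ y₀ ∧ Z x = z₀} = 0)
    (prod : ∀ᵐ z ∂puncturedMap Λ Z z₀, κ z = (κ.fst z).prod (κ.snd z))
    {f : α → ℝ≥0∞} {g : β → ℝ≥0∞} {φ : Measure {z // z ≠ z₀} → ℝ≥0∞} (hf : Measurable f)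
    (hg : Measurable g) (hφ : Measurable φ) (hf0 : f x₀ = 0) (hg0 : g y₀ = 0) :
    ∫⁻ ω, expNeg (∫⁻ x, f (X x) ∂ξ ω) * expNeg (∫⁻ x, g (Y x) ∂ξ ω) *
        φ (puncturedMap (ξ ω) Z z₀) ∂P =
      ∫⁻ ω, expNeg (∫⁻ x, f (X x) ∂ξ ω) *
        condLaplace Λ Z z₀ (fun x => (X x, Y x)) κ (fun w => g w.2) (puncturedMap (ξ ω) Z z₀) *
        φ (puncturedMap (ξ ω) Z z₀) ∂P := by
  have hW := hX.prodMk hY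
  have hf' : Measurable fun w : α × β => f w.1 := hf.comp measurable_fst
  have hg' : Measurable fun w : α × β => g w.2 := hg.comp measurable_snd
  have left := hξ.lintegral_expNeg_mul_comp_puncturedMap hκ hZ hW (hf'.add hg') hφ
  have right := hξ.lintegral_expNeg_mul_comp_puncturedMap hκ hZ hW hf'
    ((measurable_condLaplace (Λ := Λ) (Z := Z) (W := fun x => (X x, Y x)) (κ := κ) hg').mul hφ)
  simp only [Pi.add_apply, Pi.mul_apply, ← mul_assoc] at left right
  have hfX : Measurable fun x => f (X x) := hf.comp hX
  simp_rw [expNeg_lintegral_mul_expNeg_lintegral _ hfX, left, right]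
  refine lintegral_congr_ae ?_
  filter_upwards [(hξ.punctured hZ).ae_ae prod] with ω hω
  refine congrArg (· * _) (condLaplace_add hf' ?_ ?_)
  · exact lintegral_one_sub_expNeg_add_of_null hZ null hfX hf0 hg0
  · filter_upwards [hω] with z hz using lintegral_expNeg_add_of_eq_prod hz hf hg

theorem condIndepUnder_puncturedMap [MeasurableSingletonClass α] [MeasurableSingletonClass β]
    [SFinite (puncturedMap Λ Z z₀)] (hξ : IsPoissonProcess ξ Λ P) (hX : Measurable X)
    (hY : Measurable Y) (hZ : Measurable Z) (hκ : Disintegrates Λ Z z₀ (fun x => (X x, Y x)) κ)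
    (null : Λ {x | X x ≠ x₀ ∧ Y x ≠ y₀ ∧ Z x = z₀} = 0)
    (prod : ∀ᵐ z ∂puncturedMap Λ Z z₀, κ z = (κ.fst z).prod (κ.snd z)) :
    CondIndepUnder (fun ω => puncturedMap (ξ ω) X x₀) (fun ω => puncturedMap (ξ ω) Y y₀)
      (fun ω => puncturedMap (ξ ω) Z z₀) P := by
  refine condIndepUnder_of_laplace (Ψ := fun g => condLaplace Λ Z z₀ (fun x => (X x, Y x)) κ
    fun w => Function.extend Subtype.val g 0 w.2) (hξ.punctured hX).measurable
    (hξ.punctured hY).measurable (hξ.punctured hZ).measurable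
    (fun g hg => measurable_condLaplace ((measurable_extend_val hg).comp measurable_snd))
    fun f g φ hf hg hφ => ?_
  simp_rw [lintegral_puncturedMap hX hf, lintegral_puncturedMap hY hg]
  exact hξ.lintegral_expNeg_mul_condLaplace hX hY hZ hκ null prod (measurable_extend_val hf)
    (measurable_extend_val hg) hφ (extend_val_base f) (extend_val_base g)

end IsPoissonProcess

end PoissonCondIndep

section Separation

variable {γ : Type*} [MeasurableSpace γ] {ν : Measure γ}

lemma lintegral_one_sub_mul_expNeg_indicator (q : γ → ℝ≥0∞) {u : Set γ} (hu : MeasurableSet u) :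
    ∫⁻ z, (1 - q z * expNeg (u.indicator ⊤ z)) ∂ν = ν u + ∫⁻ z in uᶜ, (1 - q z) ∂ν := by
  rw [← lintegral_add_compl _ hu, ← setLIntegral_one u]
  congr 1
  · refine setLIntegral_congr_fun hu fun z hz => ?_
    simp [hz, expNeg_top]
  · refine setLIntegral_congr_fun hu.compl fun z hz => ?_
    simp [Set.indicator_of_notMem hz, expNeg_zero]

lemma eq_and_ae_eq_of_lintegral_one_sub_mul_expNeg [SigmaFinite ν] {q q' : γ → ℝ≥0∞} {K K' : ℝ≥0∞}
    (hq : Measurable q) (hq' : Measurable q') (hq1 : ∀ z, q z ≤ 1) (hq1' : ∀ z, q' z ≤ 1)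
    (fin : K + ∫⁻ z, (1 - q z) ∂ν ≠ ∞)
    (h : ∀ f : γ → ℝ≥0∞, Measurable f →
      K + ∫⁻ z, (1 - q z * expNeg (f z)) ∂ν = K' + ∫⁻ z, (1 - q' z * expNeg (f z)) ∂ν) :
    K = K' ∧ ∀ᵐ z ∂ν, q z = q' z := by
  have total : K + ∫⁻ z, (1 - q z) ∂ν = K' + ∫⁻ z, (1 - q' z) ∂ν := by
    simpa [expNeg_zero] using h 0 measurable_zero
  have off {u : Set γ} (hu : MeasurableSet u) (hνu : ν u < ∞) :
      K + ∫⁻ z in uᶜ, (1 - q z) ∂ν = K' + ∫⁻ z in uᶜ, (1 - q' z) ∂ν := by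
    have := h (u.indicator ⊤) ((measurable_const (a := ∞)).indicator hu)
    rw [lintegral_one_sub_mul_expNeg_indicator q hu, lintegral_one_sub_mul_expNeg_indicator q' hu,
      add_left_comm, add_left_comm K'] at this
    exact (ENNReal.add_right_inj hνu.ne).1 this
  have on (u : Set γ) (hu : MeasurableSet u) (hνu : ν u < ∞) :
      ∫⁻ z in u, (1 - q z) ∂ν = ∫⁻ z in u, (1 - q' z) ∂ν := by
    have split := total
    rw [← lintegral_add_compl (fun z => 1 - q z) hu, ← lintegral_add_compl (fun z => 1 - q' z) hu,
      add_left_comm, add_left_comm K', off hu hνu] at split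
    refine (ENNReal.add_left_inj (ne_top_of_le_ne_top fin ?_)).1 split
    rw [← off hu hνu]
    gcongr
    exact Measure.restrict_le_self
  have sub_eq : ∀ᵐ z ∂ν, 1 - q z = 1 - q' z :=
    ae_eq_of_forall_setLIntegral_eq_of_sigmaFinite (measurable_const.sub hq)
      (measurable_const.sub hq') on
  refine ⟨?_, ?_⟩
  · rw [← lintegral_congr_ae sub_eq] at total
    exact (ENNReal.add_left_inj (ne_top_of_le_ne_top fin le_add_self)).1 total
  · filter_upwards [sub_eq] with z hz
    rw [← ENNReal.sub_sub_cancel ENNReal.one_ne_top (hq1 z),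
      ← ENNReal.sub_sub_cancel ENNReal.one_ne_top (hq1' z), hz]

end Separation

section Void

variable {Ω S γ δ : Type*} [MeasurableSpace Ω] [MeasurableSpace S] [MeasurableSpace γ]
  [MeasurableSpace δ] [MeasurableSingletonClass γ] {Λ : Measure S} {Z : S → γ} {z₀ : γ} {W : S → δ}
  {κ : Kernel {z // z ≠ z₀} δ} [IsMarkovKernel κ] {v v₁ v₂ : δ → ℝ≥0∞}
  {P : Measure Ω} [IsProbabilityMeasure P] {ξ : Ω → Measure S}

namespace IsPoissonProcess

lemma lintegral_condLaplace_mul_condLaplace_mul_expNeg (hξ : IsPoissonProcess ξ Λ P)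
    (hZ : Measurable Z) (hv₁ : Measurable v₁) (hv₂ : Measurable v₂)
    {f : {z // z ≠ z₀} → ℝ≥0∞} (hf : Measurable f) :
    ∫⁻ ω, condLaplace Λ Z z₀ W κ v₁ (puncturedMap (ξ ω) Z z₀) *
        condLaplace Λ Z z₀ W κ v₂ (puncturedMap (ξ ω) Z z₀) *
        expNeg (∫⁻ z, f z ∂puncturedMap (ξ ω) Z z₀) ∂P =
      expNeg (∫⁻ x in Z ⁻¹' {z₀}, (1 - expNeg (v₁ (W x))) ∂Λ +
        ∫⁻ x in Z ⁻¹' {z₀}, (1 - expNeg (v₂ (W x))) ∂Λ +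
        ∫⁻ z, (1 - (∫⁻ w, expNeg (v₁ w) ∂κ z) * (∫⁻ w, expNeg (v₂ w) ∂κ z) * expNeg (f z))
          ∂puncturedMap Λ Z z₀) := by
  have hq₁ := measurable_lintegral_expNeg_kernel κ hv₁
  have hlog : Measurable fun z => negLog (∫⁻ w, expNeg (v₁ w) ∂κ z) := measurable_negLog.comp hq₁
  have key := (hξ.punctured hZ (z₀ := z₀)).lintegral_expNeg_negLog_mul_expNeg
    (hq₁.mul (measurable_lintegral_expNeg_kernel κ hv₂))
    (fun z => mul_le_one' (lintegral_expNeg_le_one κ v₁ z) (lintegral_expNeg_le_one κ v₂ z)) hf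
  simp only [Pi.mul_apply,
    negLog_mul (lintegral_expNeg_le_one κ v₁ _) (lintegral_expNeg_le_one κ v₂ _)] at key
  rw [expNeg_add, ← key, ← lintegral_const_mul' _ _ (expNeg_ne_top _)]
  refine lintegral_congr fun ω => ?_
  rw [condLaplace, condLaplace, mul_mul_mul_comm, ← expNeg_add,
    expNeg_lintegral_mul_expNeg_lintegral _ hlog, mul_assoc]

variable [SigmaFinite (puncturedMap Λ Z z₀)]

lemma eq_add_and_ae_eq_mul_of_condLaplace (hξ : IsPoissonProcess ξ Λ P)
    (hκ : Disintegrates Λ Z z₀ W κ) (hZ : Measurable Z) (hW : Measurable W) (hv : Measurable v)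
    (hv₁ : Measurable v₁) (hv₂ : Measurable v₂) (fin : ∫⁻ x, (1 - expNeg (v (W x))) ∂Λ ≠ ∞)
    (h : ∀ᵐ ω ∂P, condLaplace Λ Z z₀ W κ v (puncturedMap (ξ ω) Z z₀) =
      condLaplace Λ Z z₀ W κ v₁ (puncturedMap (ξ ω) Z z₀) *
        condLaplace Λ Z z₀ W κ v₂ (puncturedMap (ξ ω) Z z₀)) :
    ∫⁻ x in Z ⁻¹' {z₀}, (1 - expNeg (v (W x))) ∂Λ =
      ∫⁻ x in Z ⁻¹' {z₀}, (1 - expNeg (v₁ (W x))) ∂Λ +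
        ∫⁻ x in Z ⁻¹' {z₀}, (1 - expNeg (v₂ (W x))) ∂Λ ∧
    ∀ᵐ z ∂puncturedMap Λ Z z₀, ∫⁻ w, expNeg (v w) ∂κ z =
      (∫⁻ w, expNeg (v₁ w) ∂κ z) * ∫⁻ w, expNeg (v₂ w) ∂κ z := by
  have total := hκ.lintegral_one_sub_expNeg hZ hW hv measurable_zero
  simp only [Function.extend_zero, Pi.zero_apply, add_zero, expNeg_zero, mul_one] at total
  refine eq_and_ae_eq_of_lintegral_one_sub_mul_expNeg (measurable_lintegral_expNeg_kernel κ hv)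
    ((measurable_lintegral_expNeg_kernel κ hv₁).mul (measurable_lintegral_expNeg_kernel κ hv₂))
    (lintegral_expNeg_le_one κ v) (fun z => mul_le_one' (lintegral_expNeg_le_one κ v₁ z)
    (lintegral_expNeg_le_one κ v₂ z)) (total ▸ fin) fun f hf => expNeg_injective ?_
  refine (hξ.lintegral_expNeg_mul_expNeg_puncturedMap hκ hZ hW hv hf).symm.trans
    (Eq.trans ?_ (hξ.lintegral_condLaplace_mul_condLaplace_mul_expNeg hZ hv₁ hv₂ hf))
  refine (hξ.lintegral_expNeg_mul_comp_puncturedMap hκ hZ hW hv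
    (measurable_expNeg.comp (Measure.measurable_lintegral hf))).trans (lintegral_congr_ae ?_)
  filter_upwards [h] with ω hω
  rw [hω, Function.comp_apply]

end IsPoissonProcess

end Void

section CofiniteSets

variable {S α : Type*} [MeasurableSpace S] [MeasurableSpace α] {Λ : Measure S} {X : S → α} {x₀ : α}

/-- The measurable sets `s` containing `x₀` such that only finitely many points of a Poisson process
with mean measure `Λ` are expected to have `X ∉ s`. -/
def cofiniteSets (Λ : Measure S) (X : S → α) (x₀ : α) : Set (Set α) :=
  {s | MeasurableSet s ∧ x₀ ∈ s ∧ Λ (X ⁻¹' sᶜ) ≠ ∞}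

lemma isPiSystem_cofiniteSets : IsPiSystem (cofiniteSets Λ X x₀) := by
  rintro s ⟨hs, hxs, fin⟩ s' ⟨hs', hxs', fin'⟩ -
  refine ⟨hs.inter hs', ⟨hxs, hxs'⟩, ?_⟩
  rw [Set.compl_inter]
  exact measure_union_ne_top fin fin'

variable [MeasurableSingletonClass α] [SigmaFinite (puncturedMap Λ X x₀)]

lemma exists_seq_cofiniteSets_iInter_eq (hX : Measurable X) :
    ∃ T : ℕ → Set α, (∀ n, T n ∈ cofiniteSets Λ X x₀) ∧ ⋂ n, T n = {x₀} := by
  have hspan (n : ℕ) := measurableSet_spanningSets (puncturedMap Λ X x₀) n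
  refine ⟨fun n => (Subtype.val '' spanningSets (puncturedMap Λ X x₀) n)ᶜ, fun n =>
    ⟨((measurableEmbedding_ne_val x₀).measurableSet_image' (hspan n)).compl, ?_, ?_⟩, ?_⟩
  · rintro ⟨x, -, hx⟩
    exact x.2 hx
  · rw [compl_compl, ← puncturedMap_apply hX (hspan n)]
    exact (measure_spanningSets_lt_top _ n).ne
  · rw [← Set.compl_iUnion, ← Set.image_iUnion, iUnion_spanningSets, Set.image_univ,
      Subtype.range_coe_subtype]
    exact compl_compl ({x₀} : Set α)

lemma generateFrom_cofiniteSets (hX : Measurable X) :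
    MeasurableSpace.generateFrom (cofiniteSets Λ X x₀) = ‹MeasurableSpace α› := by
  refine le_antisymm (MeasurableSpace.generateFrom_le fun s hs => hs.1) ?_
  obtain ⟨T, hT, hTx⟩ := exists_seq_cofiniteSets_iInter_eq (Λ := Λ) (x₀ := x₀) hX
  have of_mem {s : Set α} (hs : MeasurableSet s) (hx : x₀ ∈ s) :
      MeasurableSet[MeasurableSpace.generateFrom (cofiniteSets Λ X x₀)] s := by
    have : s = ⋂ n, s ∪ T n := by
      rw [← Set.union_iInter, hTx, Set.union_eq_self_of_subset_right (by simpa)]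
    rw [this]
    refine MeasurableSet.iInter fun n => MeasurableSpace.measurableSet_generateFrom
      ⟨hs.union (hT n).1, .inl hx, ne_top_of_le_ne_top (hT n).2.2 (measure_mono ?_)⟩
    exact Set.preimage_mono (Set.compl_subset_compl.2 Set.subset_union_right)
  intro s hs
  by_cases hx : x₀ ∈ s
  · exact of_mem hs hx
  · exact compl_compl s ▸ (of_mem hs.compl hx).compl

end CofiniteSets

section Factorization

variable {S α β γ : Type*} [MeasurableSpace S] [mα : MeasurableSpace α] [mβ : MeasurableSpace β]
  [MeasurableSpace γ] {ν : Measure γ} [SFinite ν] {κ : Kernel γ (α × β)} [IsMarkovKernel κ]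

lemma ae_eq_prod_fst_snd_of_indepFun
    [MeasurableSpace.CountableOrCountablyGenerated γ (α × β)]
    (h : Kernel.IndepFun Prod.fst Prod.snd κ ν) : ∀ᵐ z ∂ν, κ z = (κ.fst z).prod (κ.snd z) := by
  have h' : Kernel.IndepFun Prod.fst Prod.snd κ ν.toFinite := fun s t hs ht =>
    ae_toFinite.le (h s t hs ht)
  rw [Kernel.indepFun_iff_compProd_map_prod_eq_compProd_prod_map_map measurable_fst
    measurable_snd] at h'
  filter_upwards [ae_toFinite.ge (Kernel.ae_eq_of_compProd_eq h')] with z hz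
  rw [Kernel.prod_apply, ← Kernel.fst_eq, ← Kernel.snd_eq] at hz
  exact Measure.map_id.symm.trans ((Kernel.map_apply κ measurable_id z).symm.trans hz)

lemma ae_eq_prod_fst_snd_of_isPiSystem [MeasurableSpace.CountableOrCountablyGenerated γ (α × β)]
    {p : Set (Set α)} {q : Set (Set β)} (hp : IsPiSystem p) (hq : IsPiSystem q)
    (hpα : MeasurableSpace.generateFrom p = mα) (hqβ : MeasurableSpace.generateFrom q = mβ)
    (h : ∀ s ∈ p, ∀ t ∈ q, ∀ᵐ z ∂ν, κ z (s ×ˢ t) = κ z (s ×ˢ Set.univ) * κ z (Set.univ ×ˢ t)) :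
    ∀ᵐ z ∂ν, κ z = (κ.fst z).prod (κ.snd z) := by
  refine ae_eq_prod_fst_snd_of_indepFun (Kernel.IndepSets.indep measurable_fst.comap_le
    measurable_snd.comap_le (hp.comap Prod.fst) (hq.comap Prod.snd)
    (by rw [← hpα, MeasurableSpace.comap_generateFrom]; rfl)
    (by rw [← hqβ, MeasurableSpace.comap_generateFrom]; rfl) ?_)
  rintro _ _ ⟨s, hs, rfl⟩ ⟨t, ht, rfl⟩
  simpa only [Set.prod_eq, Set.preimage_univ, Set.inter_univ, Set.univ_inter] using h s hs t ht

end Factorization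

lemma expNeg_indicator_top {δ : Type*} (r : Set δ) (w : δ) :
    expNeg (r.indicator ⊤ w) = rᶜ.indicator 1 w := by
  by_cases hw : w ∈ r <;> simp [hw, expNeg_zero, expNeg_top]

lemma one_sub_expNeg_indicator_top {δ : Type*} (r : Set δ) (w : δ) :
    1 - expNeg (r.indicator ⊤ w) = r.indicator 1 w := by
  by_cases hw : w ∈ r <;> simp [hw, expNeg_zero, expNeg_top]

section PoissonIff

variable {Ω S α β γ : Type*} [MeasurableSpace Ω] [MeasurableSpace S] [MeasurableSpace α]
  [MeasurableSpace β] [MeasurableSpace γ] [MeasurableSingletonClass α] [MeasurableSingletonClass β]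
  [MeasurableSingletonClass γ] {Λ : Measure S} {X : S → α} {Y : S → β} {Z : S → γ} {x₀ : α}
  {y₀ : β} {z₀ : γ} {κ : Kernel {z // z ≠ z₀} (α × β)} [IsMarkovKernel κ]
  {P : Measure Ω} [IsProbabilityMeasure P] {ξ : Ω → Measure S} {s : Set α} {t : Set β}

namespace IsPoissonProcess

lemma condLaplace_indicator_top_union [SFinite (puncturedMap Λ Z z₀)] (hξ : IsPoissonProcess ξ Λ P)
    (hX : Measurable X) (hY : Measurable Y) (hZ : Measurable Z)
    (hκ : Disintegrates Λ Z z₀ (fun x => (X x, Y x)) κ)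
    (h : CondIndepUnder (fun ω => puncturedMap (ξ ω) X x₀) (fun ω => puncturedMap (ξ ω) Y y₀)
      (fun ω => puncturedMap (ξ ω) Z z₀) P)
    (hs : MeasurableSet s) (ht : MeasurableSet t) (hxs : x₀ ∉ s) (hyt : y₀ ∉ t) :
    ∀ᵐ ω ∂P, condLaplace Λ Z z₀ (fun x => (X x, Y x)) κ
        ((Prod.fst ⁻¹' s ∪ Prod.snd ⁻¹' t).indicator ⊤) (puncturedMap (ξ ω) Z z₀) =
      condLaplace Λ Z z₀ (fun x => (X x, Y x)) κ ((Prod.fst ⁻¹' s).indicator ⊤)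
          (puncturedMap (ξ ω) Z z₀) *
        condLaplace Λ Z z₀ (fun x => (X x, Y x)) κ ((Prod.snd ⁻¹' t).indicator ⊤)
          (puncturedMap (ξ ω) Z z₀) := by
  have hW := hX.prodMk hY
  have hs' : MeasurableSet (Prod.fst ⁻¹' s : Set (α × β)) := measurable_fst hs
  have ht' : MeasurableSet (Prod.snd ⁻¹' t : Set (α × β)) := measurable_snd ht
  have hζ : Measurable fun ω => puncturedMap (ξ ω) Z z₀ := (hξ.punctured hZ).measurable
  have hcond {r : Set (α × β)} (hr : MeasurableSet r) :
      Measurable (condLaplace Λ Z z₀ (fun x => (X x, Y x)) κ (r.indicator ⊤)) :=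
    measurable_condLaplace ((measurable_const (a := ∞)).indicator hr)
  obtain ⟨a, b, ha, hb, has, hbt, hab⟩ :=
    (condIndepUnder_iff_mul (hξ.punctured hX).measurable hζ).1 h _ _
      (Measure.measurable_coe (measurable_subtype_coe hs) (measurableSet_singleton 0))
      (Measure.measurable_coe (measurable_subtype_coe ht) (measurableSet_singleton 0))
  have void_X : (fun ω => puncturedMap (ξ ω) X x₀) ⁻¹'
      ((fun m => m (Subtype.val ⁻¹' s)) ⁻¹' {0}) = {ω | ξ ω (X ⁻¹' s) = 0} := by
    ext ω
    simp [puncturedMap_preimage_val hX hs, Set.sdiff_singleton_eq_self hxs]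
  have void_Y : (fun ω => puncturedMap (ξ ω) Y y₀) ⁻¹'
      ((fun m => m (Subtype.val ⁻¹' t)) ⁻¹' {0}) = {ω | ξ ω (Y ⁻¹' t) = 0} := by
    ext ω
    simp [puncturedMap_preimage_val hY ht, Set.sdiff_singleton_eq_self hyt]
  have void_inter : {ω | ξ ω (X ⁻¹' s) = 0} ∩ {ω | ξ ω (Y ⁻¹' t) = 0} =
      {ω | ξ ω ((fun x => (X x, Y x)) ⁻¹' (Prod.fst ⁻¹' s ∪ Prod.snd ⁻¹' t)) = 0} := by
    ext ω
    exact measure_union_null_iff.symm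
  rw [void_X, void_Y, void_inter] at hab
  rw [void_X] at has
  rw [void_Y] at hbt
  filter_upwards [
    has.ae_eq (hξ.isCondProb_condLaplace_indicator_top hκ hZ hW hs') hζ ha (hcond hs'),
    hbt.ae_eq (hξ.isCondProb_condLaplace_indicator_top hκ hZ hW ht') hζ hb (hcond ht'),
    hab.ae_eq (hξ.isCondProb_condLaplace_indicator_top hκ hZ hW (hs'.union ht')) hζ
      (ha.mul hb) (hcond (hs'.union ht'))] with ω eX eY eXY
  rw [← eX, ← eY, eXY]

lemma null_and_ae_eq_mul_of_condIndepUnder [SigmaFinite (puncturedMap Λ Z z₀)]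
    (hξ : IsPoissonProcess ξ Λ P) (hX : Measurable X) (hY : Measurable Y) (hZ : Measurable Z)
    (hκ : Disintegrates Λ Z z₀ (fun x => (X x, Y x)) κ)
    (h : CondIndepUnder (fun ω => puncturedMap (ξ ω) X x₀) (fun ω => puncturedMap (ξ ω) Y y₀)
      (fun ω => puncturedMap (ξ ω) Z z₀) P)
    (hs : s ∈ cofiniteSets Λ X x₀) (ht : t ∈ cofiniteSets Λ Y y₀) :
    Λ (X ⁻¹' sᶜ ∩ Y ⁻¹' tᶜ ∩ Z ⁻¹' {z₀}) = 0 ∧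
    ∀ᵐ z ∂puncturedMap Λ Z z₀,
      κ z (s ×ˢ t) = κ z (s ×ˢ Set.univ) * κ z (Set.univ ×ˢ t) := by
  obtain ⟨hsm, hxs, hsΛ⟩ := hs
  obtain ⟨htm, hyt, htΛ⟩ := ht
  have hW := hX.prodMk hY
  set r₁ : Set (α × β) := Prod.fst ⁻¹' sᶜ
  set r₂ : Set (α × β) := Prod.snd ⁻¹' tᶜ
  have hr₁ : MeasurableSet r₁ := measurable_fst hsm.compl
  have hr₂ : MeasurableSet r₂ := measurable_snd htm.compl
  have lintegral_off (μ : Measure S) {r : Set (α × β)} (hr : MeasurableSet r) :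
      ∫⁻ x, (1 - expNeg (r.indicator ⊤ (X x, Y x))) ∂μ = μ ((fun x => (X x, Y x)) ⁻¹' r) := by
    simp_rw [one_sub_expNeg_indicator_top]
    exact lintegral_indicator_one (hW hr)
  have lintegral_fibre (z : {z // z ≠ z₀}) {r : Set (α × β)} (hr : MeasurableSet r) :
      ∫⁻ w, expNeg (r.indicator ⊤ w) ∂κ z = κ z rᶜ := by
    simp_rw [expNeg_indicator_top]
    exact lintegral_indicator_one hr.compl
  have fin : Λ ((fun x => (X x, Y x)) ⁻¹' (r₁ ∪ r₂)) ≠ ∞ := measure_union_ne_top hsΛ htΛ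
  have htop {r : Set (α × β)} (hr : MeasurableSet r) : Measurable (r.indicator (⊤ : _ → ℝ≥0∞)) :=
    (measurable_const (a := ∞)).indicator hr
  obtain ⟨off, fibre⟩ := hξ.eq_add_and_ae_eq_mul_of_condLaplace hκ hZ hW (htop (hr₁.union hr₂))
    (htop hr₁) (htop hr₂) (by rwa [lintegral_off Λ (hr₁.union hr₂)])
    (hξ.condLaplace_indicator_top_union hX hY hZ hκ h hsm.compl htm.compl (by simpa) (by simpa))
  simp only [lintegral_off _ hr₁, lintegral_off _ hr₂, lintegral_off _ (hr₁.union hr₂)] at off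
  simp only [lintegral_fibre _ hr₁, lintegral_fibre _ hr₂,
    lintegral_fibre _ (hr₁.union hr₂)] at fibre
  refine ⟨?_, fibre.mono fun z hz => ?_⟩
  · rw [← Measure.restrict_apply' (hZ (measurableSet_singleton z₀))]
    have fin' := ne_top_of_le_ne_top fin (Measure.restrict_apply_le (Z ⁻¹' {z₀}) _)
    refine (ENNReal.add_right_inj fin').1 ?_
    rw [add_zero]
    exact (measure_union_add_inter _ (hY htm.compl)).trans off.symm
  · simpa [r₁, r₂, Set.prod_eq, Set.compl_union] using hz

theorem condIndepUnder_puncturedMap_iff [StandardBorelSpace α] [StandardBorelSpace β]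
    [SigmaFinite (puncturedMap Λ X x₀)] [SigmaFinite (puncturedMap Λ Y y₀)]
    [SigmaFinite (puncturedMap Λ Z z₀)]
    (hξ : IsPoissonProcess ξ Λ P) (hX : Measurable X) (hY : Measurable Y) (hZ : Measurable Z)
    (hκ : Disintegrates Λ Z z₀ (fun x => (X x, Y x)) κ) :
    CondIndepUnder (fun ω => puncturedMap (ξ ω) X x₀) (fun ω => puncturedMap (ξ ω) Y y₀)
        (fun ω => puncturedMap (ξ ω) Z z₀) P ↔
      (∀ᵐ z ∂puncturedMap Λ Z z₀, κ z = (κ.fst z).prod (κ.snd z)) ∧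
        Λ {x | X x ≠ x₀ ∧ Y x ≠ y₀ ∧ Z x = z₀} = 0 := by
  refine ⟨fun h => ⟨?_, ?_⟩, fun ⟨prod, null⟩ =>
    hξ.condIndepUnder_puncturedMap hX hY hZ hκ null prod⟩
  · exact ae_eq_prod_fst_snd_of_isPiSystem isPiSystem_cofiniteSets isPiSystem_cofiniteSets
      (generateFrom_cofiniteSets hX) (generateFrom_cofiniteSets hY) fun s hs t ht =>
        (hξ.null_and_ae_eq_mul_of_condIndepUnder hX hY hZ hκ h hs ht).2
  · obtain ⟨T, hT, hTx⟩ := exists_seq_cofiniteSets_iInter_eq (Λ := Λ) (x₀ := x₀) hX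
    obtain ⟨T', hT', hTy⟩ := exists_seq_cofiniteSets_iInter_eq (Λ := Λ) (x₀ := y₀) hY
    refine measure_mono_null (fun x ⟨hx, hy, hz⟩ => ?_) (measure_iUnion_null fun n =>
      measure_iUnion_null fun k =>
        (hξ.null_and_ae_eq_mul_of_condIndepUnder hX hY hZ hκ h (hT n) (hT' k)).1)
    have hx' : X x ∉ ⋂ n, T n := hTx ▸ hx
    have hy' : Y x ∉ ⋂ n, T' n := hTy ▸ hy
    rw [Set.mem_iInter, not_forall] at hx' hy'
    obtain ⟨n, hn⟩ := hx'
    obtain ⟨k, hk⟩ := hy'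
    exact Set.mem_iUnion₂.2 ⟨n, k, ⟨hn, hk⟩, hz⟩

end IsPoissonProcess

end PoissonIff

/-! ### The analytic characterizations -/

section Disintegration

variable {S α β γ δ : Type*} [MeasurableSpace S] [MeasurableSpace α] [MeasurableSpace β]
  [MeasurableSpace γ] [MeasurableSpace δ] [MeasurableSingletonClass γ] {Λ : Measure S} {X : S → α}
  {Y : S → β} {Z : S → γ} {W : S → δ} {x₀ : α} {y₀ : β} {z₀ : γ}

lemma Disintegrates.isCondProb {κ : Kernel {z // z ≠ z₀} δ} (h : Disintegrates Λ Z z₀ W κ)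
    (hZ : Measurable Z) {r : Set δ} (hr : MeasurableSet r) :
    IsCondProb (Function.extend Subtype.val (fun z => κ z r) 0) (W ⁻¹' r) Z
      (Λ.restrict {x | Z x ≠ z₀}) := by
  intro u hu
  have hu' : MeasurableSet (Subtype.val ⁻¹' u : Set {z // z ≠ z₀}) := measurable_subtype_coe hu
  have hκr : Measurable fun z => κ z r := κ.measurable_coe hr
  calc Λ.restrict {x | Z x ≠ z₀} (W ⁻¹' r ∩ Z ⁻¹' u)
      = Λ {x | ∃ hx : Z x ≠ z₀, ((⟨Z x, hx⟩ : {z // z ≠ z₀}), W x) ∈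
          (Subtype.val ⁻¹' u) ×ˢ r} := by
        rw [Measure.restrict_apply' (measurableSet_ne hZ z₀)]
        congr 1
        ext x
        simp [and_comm, and_left_comm]
    _ = ∫⁻ z, (Subtype.val ⁻¹' u).indicator (fun z => κ z r) z ∂puncturedMap Λ Z z₀ := by
        rw [h _ (hu'.prod hr)]
        refine lintegral_congr fun z => ?_
        by_cases hz : z.1 ∈ u <;> simp [hz]
    _ = ∫⁻ x in Z ⁻¹' u, Function.extend Subtype.val (fun z => κ z r) 0 (Z x)
          ∂Λ.restrict {x | Z x ≠ z₀} := by
        rw [lintegral_puncturedMap hZ (hκr.indicator hu'), Measure.restrict_restrict (hZ hu),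
          ← lintegral_indicator ((hZ hu).inter (measurableSet_ne hZ z₀))]
        refine lintegral_congr fun x => ?_
        by_cases hz : Z x = z₀
        · simp [hz]
        · by_cases hx : Z x ∈ u <;> simp [extend_val_apply _ hz, hz, hx]

variable {κ : Kernel {z // z ≠ z₀} (α × β)}

lemma Disintegrates.condIndepUnder_restrict_right [IsMarkovKernel κ]
    (h : Disintegrates Λ Z z₀ (fun x => (X x, Y x)) κ) (hX : Measurable X) (hY : Measurable Y)
    (hZ : Measurable Z) (hfac : ∀ᵐ z ∂puncturedMap Λ Z z₀, κ z = (κ.fst z).prod (κ.snd z))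
    {t₀ : Set β} (ht₀ : MeasurableSet t₀) :
    CondIndepUnder X Y Z ((Λ.restrict {x | Z x ≠ z₀}).restrict (Y ⁻¹' t₀)) := by
  intro t ht
  have hκ {r : Set (α × β)} (hr : MeasurableSet r) : Measurable fun z => κ z r :=
    κ.measurable_coe hr
  have hb := measurable_extend_val
    ((hκ (MeasurableSet.univ.prod (ht₀.inter ht))).div (hκ (MeasurableSet.univ.prod ht₀)))
  refine ⟨_, hb, fun s hs => ?_⟩
  have joint : (X ⁻¹' s ∩ Y ⁻¹' t₀) ∩ Y ⁻¹' t = (fun x => (X x, Y x)) ⁻¹' (s ×ˢ (t₀ ∩ t)) := by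
    rw [Set.mk_preimage_prod, Set.preimage_inter, Set.inter_assoc]
  rw [Measure.restrict_restrict (hX hs), (h.isCondProb hZ (hs.prod ht₀)).restrict_iff_mul
    ((hX hs).inter (hY ht₀)) hZ (measurable_extend_val (hκ (hs.prod ht₀))) hb, joint]
  refine (h.isCondProb hZ (hs.prod (ht₀.inter ht))).congr_ae ?_
  have hfac' : ∀ᵐ z ∂puncturedMap Λ Z z₀, κ z (s ×ˢ (t₀ ∩ t)) =
      κ z (s ×ˢ t₀) * (κ z (Set.univ ×ˢ (t₀ ∩ t)) / κ z (Set.univ ×ˢ t₀)) := by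
    filter_upwards [hfac] with z hz
    rw [hz]
    simp only [Measure.prod_prod, measure_univ, one_mul, mul_assoc]
    rw [ENNReal.mul_div_cancel' (measure_mono_null Set.inter_subset_left)
      fun htop => absurd htop (measure_ne_top _ _)]
  refine ae_restrict_of_ae (((ae_puncturedMap_iff hZ (measurableSet_eq_fun
    (hκ (hs.prod (ht₀.inter ht))) ((hκ (hs.prod ht₀)).mul
    ((hκ (MeasurableSet.univ.prod (ht₀.inter ht))).div
      (hκ (MeasurableSet.univ.prod ht₀)))))).1 hfac').mono fun ω hω => ?_)
  by_cases hz : Z ω = z₀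
  · simp [hz]
  · simp only [extend_val_apply _ hz]
    exact hω hz

lemma CondIndepUnder.restrict_of_ae_eq_or (hX : Measurable X) (hY : Measurable Y)
    (hZ : Measurable Z) (hoff : Λ {x | X x ≠ x₀ ∧ Y x ≠ y₀ ∧ Z x = z₀} = 0) {s : Set α} {t : Set β}
    {u : Set γ} (hs : MeasurableSet s) (ht : MeasurableSet t) (hu : MeasurableSet u)
    (h₀ : ¬(x₀ ∈ s ∧ y₀ ∈ t ∧ z₀ ∈ u))
    (fin : Λ (X ⁻¹' s ∩ (Y ⁻¹' t ∩ Z ⁻¹' u)) ≠ ∞) :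
    CondIndepUnder X Y Z ((Λ.restrict (X ⁻¹' s ∩ (Y ⁻¹' t ∩ Z ⁻¹' u))).restrict (Z ⁻¹' {z₀})) := by
  have hR : MeasurableSet (X ⁻¹' s ∩ (Y ⁻¹' t ∩ Z ⁻¹' u)) := (hX hs).inter ((hY ht).inter (hZ hu))
  have hz : MeasurableSet (Z ⁻¹' {z₀}) := hZ (measurableSet_singleton z₀)
  set m := (Λ.restrict (X ⁻¹' s ∩ (Y ⁻¹' t ∩ Z ⁻¹' u))).restrict (Z ⁻¹' {z₀})
  have : IsFiniteMeasure (Λ.restrict (X ⁻¹' s ∩ (Y ⁻¹' t ∩ Z ⁻¹' u))) :=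
    isFiniteMeasure_restrict.2 fin
  have mem : ∀ᵐ x ∂m, X x ∈ s ∧ Y x ∈ t ∧ Z x ∈ u := ae_restrict_of_ae (ae_restrict_mem hR)
  have eq : ∀ᵐ x ∂m, Z x = z₀ := ae_restrict_mem hz
  have off : ∀ᵐ x ∂m, ¬(X x ≠ x₀ ∧ Y x ≠ y₀ ∧ Z x = z₀) :=
    ae_restrict_of_ae (ae_restrict_of_ae (measure_eq_zero_iff_ae_notMem.1 hoff))
  by_cases hx : x₀ ∈ s
  · by_cases hy : y₀ ∈ t
    · refine of_ae_const_right (y₀ := y₀) ?_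
      filter_upwards [mem, eq] with x hm hxz
      exact absurd ⟨hx, hy, hxz ▸ hm.2.2⟩ h₀
    · refine of_ae_const_left hZ (x₀ := x₀) ?_
      filter_upwards [mem, eq, off] with x hm hxz hn
      exact by_contra fun h => hn ⟨h, fun h' => hy (h' ▸ hm.2.1), hxz⟩
  · refine of_ae_const_right (y₀ := y₀) ?_
    filter_upwards [mem, eq, off] with x hm hxz hn
    exact by_contra fun h => hn ⟨fun h' => hx (h' ▸ hm.1), h, hxz⟩

lemma Disintegrates.condIndepUnder_restrict [IsMarkovKernel κ]
    (h : Disintegrates Λ Z z₀ (fun x => (X x, Y x)) κ) (hX : Measurable X) (hY : Measurable Y)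
    (hZ : Measurable Z) (hfac : ∀ᵐ z ∂puncturedMap Λ Z z₀, κ z = (κ.fst z).prod (κ.snd z))
    (hoff : Λ {x | X x ≠ x₀ ∧ Y x ≠ y₀ ∧ Z x = z₀} = 0) {s : Set α} {t : Set β}
    {u : Set γ} (hs : MeasurableSet s) (ht : MeasurableSet t) (hu : MeasurableSet u)
    (h₀ : ¬(x₀ ∈ s ∧ y₀ ∈ t ∧ z₀ ∈ u))
    (fin : Λ (X ⁻¹' s ∩ (Y ⁻¹' t ∩ Z ⁻¹' u)) ≠ ∞) :
    CondIndepUnder X Y Z (Λ.restrict (X ⁻¹' s ∩ (Y ⁻¹' t ∩ Z ⁻¹' u))) := by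
  refine .of_restrict hZ (measurableSet_singleton z₀)
    (.restrict_of_ae_eq_or hX hY hZ hoff hs ht hu h₀ fin) ?_
  rw [Measure.restrict_comm (hZ (measurableSet_singleton z₀).compl), Set.inter_comm (Y ⁻¹' t),
    ← Measure.restrict_restrict (hX hs), ← Measure.restrict_restrict (hZ hu)]
  exact ((h.condIndepUnder_restrict_right hX hY hZ hfac ht).restrict_cond hX hZ hu).restrict_left
    hX hs

lemma Disintegrates.ae_prod_eq_mul
    (h : Disintegrates Λ Z z₀ (fun x => (X x, Y x)) κ) (hX : Measurable X) (hZ : Measurable Z)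
    {u : Set γ} (hu : MeasurableSet u) (hzu : z₀ ∉ u) (fin : Λ (Z ⁻¹' u) ≠ ∞)
    (hCI : CondIndepUnder X Y Z (Λ.restrict (Z ⁻¹' u))) {s : Set α} {t : Set β}
    (hs : MeasurableSet s) (ht : MeasurableSet t) :
    ∀ᵐ x ∂Λ.restrict (Z ⁻¹' u), ∀ hz : Z x ≠ z₀,
      κ ⟨Z x, hz⟩ (s ×ˢ t) = κ ⟨Z x, hz⟩ (s ×ˢ Set.univ) * κ ⟨Z x, hz⟩ (Set.univ ×ˢ t) := by
  have : IsFiniteMeasure (Λ.restrict (Z ⁻¹' u)) := isFiniteMeasure_restrict.2 fin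
  have hm {r : Set (α × β)} (hr : MeasurableSet r) :
      Measurable (Function.extend Subtype.val (fun z => κ z r) 0) :=
    measurable_extend_val (κ.measurable_coe hr)
  have hu_sub : (Z ⁻¹' u) ∩ {x | Z x ≠ z₀} = Z ⁻¹' u :=
    Set.inter_eq_left.2 fun x hx hz => hzu (hz ▸ hx)
  have key {r : Set (α × β)} (hr : MeasurableSet r) :
      IsCondProb (Function.extend Subtype.val (fun z => κ z r) 0) ((fun x => (X x, Y x)) ⁻¹' r) Z
        (Λ.restrict (Z ⁻¹' u)) := by
    have := (h.isCondProb hZ hr).restrict_preimage hZ hu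
    rwa [Measure.restrict_restrict (hZ hu), hu_sub] at this
  obtain ⟨a, b, ha, hb, has, hbt, hab⟩ := (condIndepUnder_iff_mul hX hZ).1 hCI s t hs ht
  have hs' : MeasurableSet (s ×ˢ (Set.univ : Set β)) := hs.prod .univ
  have ht' : MeasurableSet ((Set.univ : Set α) ×ˢ t) := MeasurableSet.univ.prod ht
  have kst := key (hs.prod ht)
  have ks := key hs'
  have kt := key ht'
  rw [Set.mk_preimage_prod] at kst ks kt
  rw [Set.preimage_univ, Set.inter_univ] at ks
  rw [Set.preimage_univ, Set.univ_inter] at kt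
  filter_upwards [ks.ae_eq has hZ (hm hs') ha, kt.ae_eq hbt hZ (hm ht') hb,
    kst.ae_eq hab hZ (hm (hs.prod ht)) (ha.mul hb)] with x ea eb eab hz
  simp only [extend_val_apply _ hz] at ea eb eab
  rw [ea, eb, eab]

lemma Disintegrates.ae_eq_prod_of_condIndepUnder [IsMarkovKernel κ]
    [MeasurableSpace.CountableOrCountablyGenerated {z // z ≠ z₀} (α × β)]
    [SFinite (puncturedMap Λ Z z₀)]
    (h : Disintegrates Λ Z z₀ (fun x => (X x, Y x)) κ) (hX : Measurable X) (hZ : Measurable Z)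
    {ι : Type*} [Countable ι] {u : ι → Set γ} (hu : ∀ i, MeasurableSet (u i))
    (hU : ⋃ i, u i = {z₀}ᶜ) (fin : ∀ i, Λ (Z ⁻¹' u i) ≠ ∞)
    (hCI : ∀ i, CondIndepUnder X Y Z (Λ.restrict (Z ⁻¹' u i))) :
    ∀ᵐ z ∂puncturedMap Λ Z z₀, κ z = (κ.fst z).prod (κ.snd z) := by
  refine ae_eq_prod_fst_snd_of_isPiSystem MeasurableSpace.isPiSystem_measurableSet
    MeasurableSpace.isPiSystem_measurableSet MeasurableSpace.generateFrom_measurableSet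
    MeasurableSpace.generateFrom_measurableSet fun s hs t ht => ?_
  have hs' : MeasurableSet (s ×ˢ (Set.univ : Set β)) := hs.prod .univ
  have ht' : MeasurableSet ((Set.univ : Set α) ×ˢ t) := MeasurableSet.univ.prod ht
  refine (ae_puncturedMap_iff hZ (measurableSet_eq_fun (κ.measurable_coe (hs.prod ht))
    ((κ.measurable_coe hs').mul (κ.measurable_coe ht')))).2 ?_
  have on_part (i : ι) := h.ae_prod_eq_mul hX hZ (hu i)
    (fun hz => absurd (hU ▸ Set.mem_iUnion_of_mem i hz) (by simp)) (fin i) (hCI i) hs ht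
  have on_iUnion := (ae_restrict_iUnion_iff _ _).2 on_part
  rw [← Set.preimage_iUnion, hU, ae_restrict_iff' (hZ (measurableSet_singleton z₀).compl)]
    at on_iUnion
  exact on_iUnion.mono fun x hx hz => hx hz hz

end Disintegration

section Explosive

variable {S α β γ : Type*} [MeasurableSpace S] [MeasurableSpace α] [MeasurableSpace β]
  [MeasurableSpace γ] {Λ : Measure S} {X : S → α} {Y : S → β} {Z : S → γ} {z₀ : γ}

lemma IsCondProb.measure_inter_preimage_singleton [MeasurableSingletonClass γ] {b : γ → ℝ≥0∞}
    {F : Set S} (h : IsCondProb b F Z Λ) (hZ : Measurable Z) :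
    Λ (F ∩ Z ⁻¹' {z₀}) = b z₀ * Λ (Z ⁻¹' {z₀}) := by
  rw [h _ (measurableSet_singleton z₀), setLIntegral_congr_fun
    (hZ (measurableSet_singleton z₀)) fun x (hx : Z x = z₀) => congrArg b hx, setLIntegral_const]

lemma measure_eq_zero_of_condIndepUnder [MeasurableSingletonClass γ] (hX : Measurable X)
    (hZ : Measurable Z) {s : ℕ → Set α} (hs : ∀ h, MeasurableSet (s h)) (hmono : Monotone s)
    (fin : ∀ h, Λ (X ⁻¹' s h) ≠ ∞) (hCI : ∀ h, CondIndepUnder X Y Z (Λ.restrict (X ⁻¹' s h)))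
    (hexp : Λ (X ⁻¹' (⋃ h, s h) ∩ Z ⁻¹' {z₀}) = 0 ∨ Λ (X ⁻¹' (⋃ h, s h) ∩ Z ⁻¹' {z₀}) = ∞)
    {t : Set β} (ht : MeasurableSet t) (fin_t : Λ (Y ⁻¹' t) ≠ ∞) :
    Λ (X ⁻¹' (⋃ h, s h) ∩ (Y ⁻¹' t ∩ Z ⁻¹' {z₀})) = 0 := by
  set p := fun h => Λ (X ⁻¹' s h ∩ Z ⁻¹' {z₀})
  set q := fun h => Λ (X ⁻¹' s h ∩ (Y ⁻¹' t ∩ Z ⁻¹' {z₀}))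
  have cross (k h : ℕ) (hkh : k ≤ h) : q k * p h = p k * q h := by
    obtain ⟨b, -, hb⟩ := hCI h t ht
    have eq_mul (j : ℕ) (hj : j ≤ h) : q j = b z₀ * p j := by
      have := (hb _ (hs j)).measure_inter_preimage_singleton (z₀ := z₀) hZ
      rwa [Measure.restrict_restrict (hX (hs j)), ← Set.preimage_inter,
        Set.inter_eq_left.2 (hmono hj), Measure.restrict_apply' (hX (hs j)),
        Measure.restrict_apply' (hX (hs j)), Set.inter_comm, Set.inter_comm (Z ⁻¹' _)] at this
    rw [eq_mul k hkh, eq_mul h le_rfl]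
    ring
  have p_mono : Monotone fun h => X ⁻¹' s h ∩ Z ⁻¹' {z₀} := fun a b hab =>
    Set.inter_subset_inter_left _ (Set.preimage_mono (hmono hab))
  have bound (k h : ℕ) : q k * p h ≤ p k * Λ (Y ⁻¹' t) :=
    calc q k * p h ≤ q k * p (max k h) := by gcongr; exact measure_mono (p_mono (le_max_right k h))
      _ = p k * q (max k h) := cross k _ (le_max_left k h)
      _ ≤ p k * Λ (Y ⁻¹' t) := by gcongr; exact measure_mono fun x hx => hx.2.1
  rcases hexp with zero | top
  · refine measure_mono_null ?_ zero
    exact fun x hx => ⟨hx.1, hx.2.2⟩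
  rw [Set.preimage_iUnion, Set.iUnion_inter, measure_iUnion_null_iff]
  intro k
  by_contra hk
  have iSup_p : ⨆ h, p h = ∞ := by
    rw [← top, Set.preimage_iUnion, Set.iUnion_inter, p_mono.measure_iUnion]
  have : q k * ∞ ≤ p k * Λ (Y ⁻¹' t) := by
    rw [← iSup_p, ENNReal.mul_iSup]
    exact iSup_le (bound k)
  rw [ENNReal.mul_top hk, top_le_iff] at this
  exact ENNReal.mul_ne_top (measure_ne_top_of_subset Set.inter_subset_left (fin k)) fin_t this

end Explosive

section Coords

variable {ι : Type*} {E : ι → Type*} {o : ∀ i, E i} {A B C : Finset ι} {y : Punctured o}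

lemma coords_eq_iff : coords o A y = A.restrict o ↔ ∀ i ∈ A, y.1 i = o i :=
  ⟨fun h i hi => congrFun h ⟨i, hi⟩, fun h => funext fun i => h i i.2⟩

lemma coords_eq_of_eq_empty (hA : A = ∅) (y : Punctured o) : coords o A y = A.restrict o :=
  coords_eq_iff.2 fun i hi => absurd (hA ▸ hi) (Finset.notMem_empty i)

lemma restrict_coords_eq_iff {D : Finset ι} {A : Finset D} :
    A.restrict (coords o D y) = A.restrict (D.restrict o) ↔
      coords o (A.map (.subtype _)) y = (A.map (.subtype _)).restrict o := by
  rw [coords_eq_iff, Finset.forall_mem_map]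
  exact ⟨fun h i hi => congrFun h ⟨i, hi⟩, fun h => funext fun i => h i i.2⟩

lemma slab_eq_pi [DecidableEq ι] (L : ℕ → ∀ i, Set (E i)) (h : ℕ) (i : ι) :
    slab L h i = Set.univ.pi (Function.update (fun _ => Set.univ) i (L h i)) := by
  rw [← Set.eval_preimage]
  rfl

lemma mem_univ_pi_iff_restrict [Fintype ι] [DecidableEq ι] (hABC : A ∪ B ∪ C = Finset.univ)
    {R : ∀ i, Set (E i)} {x : ∀ i, E i} :
    x ∈ Set.univ.pi R ↔ A.restrict x ∈ Set.univ.pi (A.restrict R) ∧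
      B.restrict x ∈ Set.univ.pi (B.restrict R) ∧ C.restrict x ∈ Set.univ.pi (C.restrict R) := by
  have cover (i : ι) : i ∈ A ∨ i ∈ B ∨ i ∈ C := by
    simpa [or_assoc] using hABC.ge (Finset.mem_univ i)
  simp only [Set.mem_univ_pi]
  refine ⟨fun h => ⟨fun i => h i, fun i => h i, fun i => h i⟩, fun ⟨hA, hB, hC⟩ i => ?_⟩
  rcases cover i with hi | hi | hi
  exacts [hA ⟨i, hi⟩, hB ⟨i, hi⟩, hC ⟨i, hi⟩]

end Coords

section Analytic

variable {ι : Type*} {E : ι → Type*} [∀ i, MeasurableSpace (E i)] {o : ∀ i, E i}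
  {L : ℕ → ∀ i, Set (E i)} {Λ : Measure (Punctured o)} {A B C : Finset ι}

lemma measurable_coords (o : ∀ i, E i) (A : Finset ι) : Measurable (coords o A) :=
  A.measurable_restrict.comp measurable_subtype_coe

lemma factorizes_of_eq_empty (hC : C = ∅)
    (κ : Kernel (Punctured (C.restrict o)) ((∀ i : A, E i) × (∀ i : B, E i))) :
    Factorizes o Λ A B C κ := by
  subst hC
  exact .of_forall fun z => absurd (Subsingleton.elim _ _) z.2

lemma condIndepOn_iff {Q : Set (∀ i, E i)} (pos : mass o Λ Q ≠ 0) (fin : mass o Λ Q ≠ ∞) :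
    CondIndepOn o Λ A B C Q ↔ CondIndepUnder (coords o A) (coords o B) (coords o C)
      (Λ.restrict (Subtype.val ⁻¹' Q)) :=
  condIndepIndexed_cond_iff (measurable_coords o A) (measurable_coords o B)
    (measurable_coords o C) (fun hC => ⟨_, coords_eq_of_eq_empty hC⟩) pos fin

namespace LocalizedExplosive

lemma monotone_loc (hΛ : LocalizedExplosive o L Λ) (i : ι) : Monotone fun h => L h i :=
  monotone_nat_of_le_succ fun h => hΛ.loc_subset_succ h i

lemma measure_eval_mem_loc_lt_top (hΛ : LocalizedExplosive o L Λ) (h : ℕ) (i : ι) :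
    Λ {y | y.1 i ∈ L h i} < ∞ :=
  hΛ.locallyFinite (slab L h i) (measurable_pi_apply i (hΛ.measurableSet_loc h i))
    ⟨h, fun _ hy => ⟨i, hy⟩⟩

lemma ne_iff_exists_mem_loc (hΛ : LocalizedExplosive o L Λ) {i : ι} {x : E i} :
    x ≠ o i ↔ ∃ h, x ∈ L h i := by
  rw [← Set.mem_iUnion, hΛ.iUnion_loc, Set.mem_compl_singleton_iff]

lemma iUnion_eval_mem_loc (hΛ : LocalizedExplosive o L Λ) (A : Finset ι) :
    ⋃ p : A × ℕ, {x : ∀ i : A, E i | x p.1 ∈ L p.2 p.1} = {A.restrict o}ᶜ := by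
  ext x
  simp only [Set.mem_iUnion, Prod.exists, Set.mem_ofPred_eq, ← hΛ.ne_iff_exists_mem_loc]
  exact Function.ne_iff.symm

lemma sigmaFinite_marginal [∀ i, MeasurableSingletonClass (E i)]
    (hΛ : LocalizedExplosive o L Λ) (A : Finset ι) : SigmaFinite (marginal o Λ A) := by
  have hm (p : A × ℕ) : MeasurableSet {x : ∀ i : A, E i | x p.1 ∈ L p.2 p.1} :=
    measurable_pi_apply p.1 (hΛ.measurableSet_loc p.2 p.1)
  refine Measure.sigmaFinite_of_countable (Set.countable_range fun p : A × ℕ =>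
    (Subtype.val ⁻¹' {x | x p.1 ∈ L p.2 p.1} : Set (Punctured (A.restrict o)))) ?_ ?_
  · rintro - ⟨p, rfl⟩
    refine (puncturedMap_preimage_val (measurable_coords o A) (hm p)).trans_lt ?_
    exact (measure_mono fun y hy => hy.1).trans_lt (hΛ.measure_eval_mem_loc_lt_top p.2 p.1)
  · rw [Set.sUnion_range, ← Set.preimage_iUnion, hΛ.iUnion_eval_mem_loc]
    exact Set.eq_univ_of_forall fun x => x.2

lemma measure_eval_ne_coords_eq (hΛ : LocalizedExplosive o L Λ) (i : ι) (C : Finset ι) :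
    Λ {y | y.1 i ≠ o i ∧ coords o C y = C.restrict o} = 0 ∨
      Λ {y | y.1 i ≠ o i ∧ coords o C y = C.restrict o} = ∞ := by
  by_cases hi : i ∈ C
  · left
    convert measure_empty (μ := Λ)
    exact Set.eq_empty_of_forall_notMem fun y hy => hy.1 (coords_eq_iff.1 hy.2 i hi)
  · simpa [coords_eq_iff (A := {i})] using
      hΛ.explosive {i} C (Finset.disjoint_singleton_left.2 hi) (Finset.singleton_nonempty i)

lemma measure_preimage_coords [Finite ι] (hΛ : LocalizedExplosive o L Λ) (A : Finset ι) :
    Λ (coords o A ⁻¹' {A.restrict o}) = 0 ∨ Λ (coords o A ⁻¹' {A.restrict o}) = ∞ := by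
  classical
  have := Fintype.ofFinite ι
  have coords_compl_ne (y : Punctured o) (hy : coords o A y = A.restrict o) :
      coords o Aᶜ y ≠ Aᶜ.restrict o := fun h => y.2 <| funext fun i =>
    (em (i ∈ A)).elim (coords_eq_iff.1 hy i) fun hi =>
      coords_eq_iff.1 h i (Finset.mem_compl.2 hi)
  have eq_inter : coords o A ⁻¹' {A.restrict o} =
      {y | coords o Aᶜ y ≠ Aᶜ.restrict o ∧ coords o A y = A.restrict o} :=
    Set.ext fun y => ⟨fun hy => ⟨coords_compl_ne y hy, hy⟩, And.right⟩
  rcases (Aᶜ).eq_empty_or_nonempty with hA | hA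
  · left
    convert measure_empty (μ := Λ)
    exact Set.eq_empty_of_forall_notMem fun y hy =>
      coords_compl_ne y hy (coords_eq_of_eq_empty hA y)
  · exact eq_inter ▸ hΛ.explosive _ _ disjoint_compl_left hA

lemma marginal [∀ i, MeasurableSingletonClass (E i)] (hΛ : LocalizedExplosive o L Λ)
    (D : Finset ι) :
    LocalizedExplosive (D.restrict o) (fun h => D.restrict (L h)) (marginal o Λ D) := by
  refine ⟨fun h i => hΛ.measurableSet_loc h i, fun h i => hΛ.loc_subset_succ h i,
    fun i => hΛ.iUnion_loc i, fun G hG ⟨h, hh⟩ => ?_, fun A B hAB hA => ?_⟩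
  · refine (puncturedMap_preimage_val (measurable_coords o D) hG).trans_lt ?_
    refine (measure_mono (Set.preimage_mono Set.sdiff_subset)).trans_lt ?_
    exact hΛ.locallyFinite (D.restrict ⁻¹' G) (D.measurable_restrict hG)
      ⟨h, fun y hy => (hh hy).imp' Subtype.val fun _ hi => hi⟩
  · have hm : MeasurableSet {x : ∀ i : D, E i | A.restrict x ≠ A.restrict (D.restrict o) ∧
        B.restrict x = B.restrict (D.restrict o)} :=
      (A.measurable_restrict (measurableSet_singleton _)).compl.inter
        (B.measurable_restrict (measurableSet_singleton _))
    have key := hΛ.explosive (A.map (.subtype _)) (B.map (.subtype _))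
      ((Finset.disjoint_map _).2 hAB) hA.map
    simp only [ne_eq, ← restrict_coords_eq_iff] at key
    have eq_measure := puncturedMap_preimage_val (μ := Λ) (z₀ := D.restrict o)
      (measurable_coords o D) hm
    rw [Set.sdiff_singleton_eq_self fun h => h.1 rfl] at eq_measure
    exact eq_measure.symm ▸ key

end LocalizedExplosive

lemma AdmitsCondIndep.condIndepOnSlabs (hΛ : LocalizedExplosive o L Λ)
    (h : AdmitsCondIndep o L Λ A B C) (I : Finset ι) : CondIndepOnSlabs o L Λ A B C I := by
  classical
  intro i _ n pos
  have bdd : IsBdd L (slab L n i) := ⟨n, fun _ hy => ⟨i, hy⟩⟩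
  rw [slab_eq_pi] at pos bdd ⊢
  refine h _ (fun j => ?_) pos bdd
  rcases eq_or_ne j i with rfl | hj
  · simpa using hΛ.measurableSet_loc n j
  · simp [hj]

namespace CondIndepOnSlabs

variable {I : Finset ι}

lemma condIndepUnder (hI : CondIndepOnSlabs o L Λ A B C I) (hΛ : LocalizedExplosive o L Λ)
    {i : ι} (hi : i ∈ I) (h : ℕ) :
    CondIndepUnder (coords o A) (coords o B) (coords o C) (Λ.restrict {y | y.1 i ∈ L h i}) := by
  by_cases null : mass o Λ (slab L h i) = 0
  · rw [show Λ.restrict {y | y.1 i ∈ L h i} = 0 from Measure.restrict_eq_zero.2 null]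
    exact .of_ae_const_right (y₀ := B.restrict o) (by simp)
  · exact (condIndepOn_iff null (hΛ.measure_eval_mem_loc_lt_top h i).ne).1
      (hI i hi h (pos_iff_ne_zero.2 null))

lemma nullOffC [∀ i, MeasurableSingletonClass (E i)] (hA : CondIndepOnSlabs o L Λ A B C A)
    (hΛ : LocalizedExplosive o L Λ) : NullOffC o Λ A B C := by
  have null_of_mem (v : A) (w : B) (k : ℕ) :
      Λ {y | y.1 v ≠ o v ∧ y.1 w ∈ L k w ∧ coords o C y = C.restrict o} = 0 := by
    have iUnion_eq : (⋃ h, {x : ∀ i : A, E i | x v ∈ L h v}) = {x | x v ≠ o v} :=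
      Set.ext fun x => by simp [hΛ.ne_iff_exists_mem_loc]
    have null := measure_eq_zero_of_condIndepUnder (z₀ := C.restrict o) (measurable_coords o A)
      (measurable_coords o C) (s := fun h => {x | x v ∈ L h v})
      (fun h => measurable_pi_apply v (hΛ.measurableSet_loc h v))
      (fun a b hab x hx => hΛ.monotone_loc _ hab hx)
      (fun h => (hΛ.measure_eval_mem_loc_lt_top h v).ne)
      (fun h => hA.condIndepUnder hΛ v.2 h)
      (iUnion_eq ▸ hΛ.measure_eval_ne_coords_eq v C)
      (t := {x | x w ∈ L k w}) (measurable_pi_apply w (hΛ.measurableSet_loc k w))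
      (hΛ.measure_eval_mem_loc_lt_top k w).ne
    rwa [iUnion_eq] at null
  refine measure_mono_null (fun y ⟨hyA, hyB, hyC⟩ => ?_)
    (measure_iUnion_null fun v => measure_iUnion_null fun w => measure_iUnion_null fun k =>
      null_of_mem v w k)
  obtain ⟨v, hv⟩ := Function.ne_iff.1 hyA
  obtain ⟨w, hw⟩ := Function.ne_iff.1 hyB
  obtain ⟨k, hk⟩ := hΛ.ne_iff_exists_mem_loc.1 hw
  simp only [Set.mem_iUnion]
  exact ⟨v, w, k, hv, hk, hyC⟩

lemma factorizes [∀ i, StandardBorelSpace (E i)] (hC : CondIndepOnSlabs o L Λ A B C C)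
    (hΛ : LocalizedExplosive o L Λ)
    {κ : Kernel (Punctured (C.restrict o)) ((∀ i : A, E i) × (∀ i : B, E i))}
    (hκ : IsDisintegration o Λ A B C κ) : Factorizes o Λ A B C κ := by
  have := hκ.1
  have : SigmaFinite (puncturedMap Λ (coords o C) (C.restrict o)) := hΛ.sigmaFinite_marginal C
  exact Disintegrates.ae_eq_prod_of_condIndepUnder hκ.2 (measurable_coords o A)
    (measurable_coords o C) (u := fun p : C × ℕ => {x | x p.1 ∈ L p.2 p.1})
    (fun p => measurable_pi_apply p.1 (hΛ.measurableSet_loc p.2 p.1))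
    (hΛ.iUnion_eval_mem_loc C) (fun p => (hΛ.measure_eval_mem_loc_lt_top p.2 p.1).ne)
    (fun p => hC.condIndepUnder hΛ p.1.2 p.2)

end CondIndepOnSlabs

lemma Factorizes.admitsCondIndep [Fintype ι] [DecidableEq ι]
    [∀ i, MeasurableSingletonClass (E i)]
    {κ : Kernel (Punctured (C.restrict o)) ((∀ i : A, E i) × (∀ i : B, E i))}
    (hfac : Factorizes o Λ A B C κ) (hκ : IsDisintegration o Λ A B C κ)
    (hnull : NullOffC o Λ A B C) (hΛ : LocalizedExplosive o L Λ)
    (hABC : A ∪ B ∪ C = Finset.univ) : AdmitsCondIndep o L Λ A B C := by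
  have := hκ.1
  intro R hR pos bdd
  have fin : mass o Λ (Set.univ.pi R) < ∞ := hΛ.locallyFinite _ (.univ_pi hR) bdd
  have base_notMem : o ∉ Set.univ.pi R := fun ho => by
    obtain ⟨h, hh⟩ := bdd
    obtain ⟨i, hi⟩ := hh ho
    exact hΛ.ne_iff_exists_mem_loc.2 ⟨h, hi⟩ rfl
  have preimage_eq : (Subtype.val ⁻¹' Set.univ.pi R : Set (Punctured o)) =
      coords o A ⁻¹' Set.univ.pi (A.restrict R) ∩
        (coords o B ⁻¹' Set.univ.pi (B.restrict R) ∩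
          coords o C ⁻¹' Set.univ.pi (C.restrict R)) :=
    Set.ext fun _ => mem_univ_pi_iff_restrict hABC
  rw [condIndepOn_iff pos.ne' fin.ne, preimage_eq]
  exact Disintegrates.condIndepUnder_restrict hκ.2 (measurable_coords o A)
    (measurable_coords o B) (measurable_coords o C) hfac hnull (.univ_pi fun i => hR i)
    (.univ_pi fun i => hR i) (.univ_pi fun i => hR i)
    (fun h => base_notMem ((mem_univ_pi_iff_restrict hABC).2 h)) (preimage_eq ▸ fin.ne)

namespace LocalizedExplosive

variable [∀ i, StandardBorelSpace (E i)]

lemma exists_isDisintegration (hΛ : LocalizedExplosive o L Λ) (A B C : Finset ι) :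
    ∃ κ, IsDisintegration o Λ A B C κ := by
  have : Nonempty ((∀ i : A, E i) × (∀ i : B, E i)) := ⟨A.restrict o, B.restrict o⟩
  have : SigmaFinite (puncturedMap Λ (coords o C) (C.restrict o)) := hΛ.sigmaFinite_marginal C
  exact exists_disintegrates (measurable_coords o C)
    ((measurable_coords o A).prodMk (measurable_coords o B))

variable [Fintype ι] [DecidableEq ι]

lemma admitsCondIndep_iff (hΛ : LocalizedExplosive o L Λ) (hABC : A ∪ B ∪ C = Finset.univ)
    {κ : Kernel (Punctured (C.restrict o)) ((∀ i : A, E i) × (∀ i : B, E i))}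
    (hκ : IsDisintegration o Λ A B C κ) :
    AdmitsCondIndep o L Λ A B C ↔ Factorizes o Λ A B C κ ∧ NullOffC o Λ A B C :=
  ⟨fun h => ⟨(h.condIndepOnSlabs hΛ C).factorizes hΛ hκ, (h.condIndepOnSlabs hΛ A).nullOffC hΛ⟩,
    fun ⟨hfac, hnull⟩ => hfac.admitsCondIndep hκ hnull hΛ hABC⟩

theorem tfae (hΛ : LocalizedExplosive o L Λ) (hABC : A ∪ B ∪ C = Finset.univ) :
    [AdmitsCondIndep o L Λ A B C,
      CondIndepOnSlabs o L Λ A B C Finset.univ,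
      CondIndepOnSlabs o L Λ A B C C ∧ NullOffC o Λ A B C,
      (C.Nonempty → ∃ κ, IsDisintegration o Λ A B C κ ∧ Factorizes o Λ A B C κ) ∧
        NullOffC o Λ A B C,
      (C.Nonempty → ∀ κ, IsDisintegration o Λ A B C κ → Factorizes o Λ A B C κ) ∧
        NullOffC o Λ A B C].TFAE := by
  obtain ⟨κ, hκ⟩ := hΛ.exists_isDisintegration A B C
  tfae_have 1 → 2 := fun h => h.condIndepOnSlabs hΛ _
  tfae_have 2 → 3 := fun h => ⟨fun i _ => h i (Finset.mem_univ i),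
    CondIndepOnSlabs.nullOffC (fun i _ => h i (Finset.mem_univ i)) hΛ⟩
  tfae_have 3 → 5 := fun ⟨hC, hnull⟩ => ⟨fun _ _ hκ' => hC.factorizes hΛ hκ', hnull⟩
  tfae_have 5 → 4 := fun ⟨hfac, hnull⟩ => ⟨fun hC => ⟨κ, hκ, hfac hC κ hκ⟩, hnull⟩
  tfae_have 4 → 1 := by
    rintro ⟨hfac, hnull⟩
    rcases C.eq_empty_or_nonempty with hC | hC
    · exact (factorizes_of_eq_empty hC κ).admitsCondIndep hκ hnull hΛ hABC
    · obtain ⟨κ', hκ', hfac'⟩ := hfac hC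
      exact hfac'.admitsCondIndep hκ' hnull hΛ hABC
  tfae_finish

end LocalizedExplosive

end Analytic

/-! ### Marginals and projections -/

section Projections

variable {ι : Type*} {E : ι → Type*} [∀ i, MeasurableSpace (E i)] {A B C D : Finset ι}

/-- The reindexing of a family over `A` by the elements of `A` regarded as elements of `D`. It
identifies `coords o A y` with the coordinates over `A.subtype (· ∈ D)` of `coords o D y`. -/
def piSubtypeEquiv [DecidablePred (· ∈ D)] (hAD : A ⊆ D) :
    (∀ i : A, E i) ≃ᵐ ∀ i : A.subtype (· ∈ D), E i where
  toFun x i := x ⟨i.1.1, Finset.mem_subtype.1 i.2⟩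
  invFun x i := x ⟨⟨i.1, hAD i.2⟩, Finset.mem_subtype.2 i.2⟩
  left_inv _ := rfl
  right_inv _ := rfl
  measurable_toFun := measurable_pi_lambda _ fun _ => measurable_pi_apply _
  measurable_invFun := measurable_pi_lambda _ fun _ => measurable_pi_apply _

variable {o : ∀ i, E i} {L : ℕ → ∀ i, Set (E i)} {Λ : Measure (Punctured o)} {Ω : Type*}
  [MeasurableSpace Ω] {P : Measure Ω} {ξ : Ω → Measure (Punctured o)}

lemma measurable_restrict_coords (o : ∀ i, E i) (D : Finset ι) (A : Finset D) :
    Measurable fun y : Punctured o => A.restrict (coords o D y) :=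
  A.measurable_restrict.comp (measurable_coords o D)

lemma condIndepUnder_map_restrict_coords_iff [DecidablePred (· ∈ D)] (hA : A ⊆ D) (hB : B ⊆ D)
    (hC : C ⊆ D) :
    CondIndepUnder (fun ω => (ξ ω).map fun y => (A.subtype (· ∈ D)).restrict (coords o D y))
        (fun ω => (ξ ω).map fun y => (B.subtype (· ∈ D)).restrict (coords o D y))
        (fun ω => (ξ ω).map fun y => (C.subtype (· ∈ D)).restrict (coords o D y)) P ↔
      CondIndepUnder (proj o ξ A) (proj o ξ B) (proj o ξ C) P :=
  ⟨fun h => h.map_comp (measurable_restrict_coords o D _) (measurable_restrict_coords o D _)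
      (measurable_restrict_coords o D _) (piSubtypeEquiv hA).symm.measurable
      (piSubtypeEquiv hB).symm.measurable (piSubtypeEquiv hC).symm.measurable
      (piSubtypeEquiv hC).measurable (piSubtypeEquiv hC).apply_symm_apply,
    fun h => h.map_comp (measurable_coords o A) (measurable_coords o B) (measurable_coords o C)
      (piSubtypeEquiv hA).measurable (piSubtypeEquiv hB).measurable
      (piSubtypeEquiv hC).measurable (piSubtypeEquiv hC).symm.measurable
      (piSubtypeEquiv hC).symm_apply_apply⟩

lemma marginal_marginal [∀ i, MeasurableSingletonClass (E i)] (A : Finset D) :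
    marginal (D.restrict o) (marginal o Λ D) A =
      puncturedMap Λ (fun y => A.restrict (coords o D y)) (A.restrict (D.restrict o)) :=
  puncturedMap_puncturedMap (measurable_coords o D) A.measurable_restrict

lemma LocalizedExplosive.measure_preimage_restrict_coords [Finite ι]
    (hΛ : LocalizedExplosive o L Λ) (A : Finset D) :
    Λ ((fun y => A.restrict (coords o D y)) ⁻¹' {A.restrict (D.restrict o)}) = 0 ∨
      Λ ((fun y => A.restrict (coords o D y)) ⁻¹' {A.restrict (D.restrict o)}) = ∞ := by
  have preimage_eq : (fun y => A.restrict (coords o D y)) ⁻¹' {A.restrict (D.restrict o)} =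
      coords o (A.map (.subtype _)) ⁻¹' {(A.map (.subtype _)).restrict o} :=
    Set.ext fun _ => restrict_coords_eq_iff
  exact preimage_eq ▸ hΛ.measure_preimage_coords _

variable [IsProbabilityMeasure P]

lemma IsPoissonProcess.condIndepIndexed_proj_iff [Finite ι]
    [∀ i, MeasurableSingletonClass (E i)] (hξ : IsPoissonProcess ξ Λ P)
    (hΛ : LocalizedExplosive o L Λ) :
    CondIndepIndexed C (proj o ξ A) (proj o ξ B) (proj o ξ C) P ↔
      CondIndepUnder (proj o ξ A) (proj o ξ B) (proj o ξ C) P := by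
  have measurable_proj (I : Finset ι) : Measurable (proj o ξ I) :=
    (Measure.measurable_map _ (measurable_coords o I)).comp hξ.measurable
  refine condIndepIndexed_iff_condIndepUnder (measurable_proj A) (measurable_proj B)
    (measurable_proj C) fun hC => ?_
  have : IsEmpty (Punctured (C.restrict o)) := by
    subst hC
    exact ⟨fun z => z.2 (Subsingleton.elim _ _)⟩
  refine ⟨Λ (coords o C ⁻¹' {C.restrict o}) • Measure.dirac (C.restrict o), ?_⟩
  filter_upwards [hξ.ae_map_eq (measurable_coords o C) (hΛ.measure_preimage_coords C)] with ω hω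
  rwa [Measure.eq_zero_of_isEmpty (puncturedMap _ _ _), Measure.map_zero, zero_add] at hω

namespace LocalizedExplosive

variable [∀ i, StandardBorelSpace (E i)] [DecidableEq ι]

lemma admitsCondIndep_iff_marginal [Fintype ι] (hΛ : LocalizedExplosive o L Λ)
    (hξ : IsPoissonProcess ξ Λ P) (hABC : A ∪ B ∪ C = Finset.univ) :
    AdmitsCondIndep o L Λ A B C ↔
      CondIndepUnder (fun ω => PuncturedCI.marginal o (ξ ω) A)
        (fun ω => PuncturedCI.marginal o (ξ ω) B)
        (fun ω => PuncturedCI.marginal o (ξ ω) C) P := by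
  obtain ⟨κ, hκ⟩ := hΛ.exists_isDisintegration A B C
  have := hκ.1
  have sigmaFinite (I : Finset ι) : SigmaFinite (puncturedMap Λ (coords o I) (I.restrict o)) :=
    hΛ.sigmaFinite_marginal I
  exact (hΛ.admitsCondIndep_iff hABC hκ).trans (hξ.condIndepUnder_puncturedMap_iff
    (measurable_coords o A) (measurable_coords o B) (measurable_coords o C) hκ.2).symm

theorem admitsCondIndep_iff_proj [Fintype ι] (hΛ : LocalizedExplosive o L Λ)
    (hξ : IsPoissonProcess ξ Λ P) (hABC : A ∪ B ∪ C = Finset.univ) :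
    AdmitsCondIndep o L Λ A B C ↔
      CondIndepIndexed C (proj o ξ A) (proj o ξ B) (proj o ξ C) P := by
  rw [hΛ.admitsCondIndep_iff_marginal hξ hABC, hξ.condIndepIndexed_proj_iff hΛ]
  exact (hξ.condIndepUnder_map_iff_puncturedMap (measurable_coords o A) (measurable_coords o B)
    (measurable_coords o C) (hΛ.measure_preimage_coords A) (hΛ.measure_preimage_coords B)
    (hΛ.measure_preimage_coords C)).symm

theorem admitsCondIndep_marginal_iff_proj [Finite ι] (hΛ : LocalizedExplosive o L Λ)
    (hξ : IsPoissonProcess ξ Λ P) (hA : A ⊆ D) (hB : B ⊆ D) (hC : C ⊆ D)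
    (hABC : A.subtype (· ∈ D) ∪ B.subtype (· ∈ D) ∪ C.subtype (· ∈ D) = Finset.univ) :
    AdmitsCondIndep (D.restrict o) (fun h => D.restrict (L h)) (PuncturedCI.marginal o Λ D)
        (A.subtype (· ∈ D)) (B.subtype (· ∈ D)) (C.subtype (· ∈ D)) ↔
      CondIndepIndexed C (proj o ξ A) (proj o ξ B) (proj o ξ C) P := by
  rw [(hΛ.marginal D).admitsCondIndep_iff_marginal (hξ.punctured (measurable_coords o D)) hABC,
    hξ.condIndepIndexed_proj_iff hΛ, ← condIndepUnder_map_restrict_coords_iff hA hB hC,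
    hξ.condIndepUnder_map_iff_puncturedMap (measurable_restrict_coords o D _)
      (measurable_restrict_coords o D _) (measurable_restrict_coords o D _)
      (hΛ.measure_preimage_restrict_coords _) (hΛ.measure_preimage_restrict_coords _)
      (hΛ.measure_preimage_restrict_coords _)]
  simp only [← marginal_marginal]
  rfl

end LocalizedExplosive

end Projections

end PuncturedCI

theorem theorem4_general {V : Type*} [Fintype V] [DecidableEq V] {E : V → Type*}
    [∀ v, MeasurableSpace (E v)] [∀ v, StandardBorelSpace (E v)]
    (o : ∀ v, E v) (L : ℕ → ∀ v, Set (E v)) (Λ : Measure (Punctured o))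
    (hΛ : LocalizedExplosive o L Λ)
    (A B C : Finset V) :
    (A ∪ B ∪ C = Finset.univ →
      [AdmitsCondIndep o L Λ A B C,
        CondIndepOnSlabs o L Λ A B C Finset.univ,
        CondIndepOnSlabs o L Λ A B C C ∧ NullOffC o Λ A B C,
        (C.Nonempty → ∃ κ, IsDisintegration o Λ A B C κ ∧ Factorizes o Λ A B C κ) ∧
          NullOffC o Λ A B C,
        (C.Nonempty → ∀ κ, IsDisintegration o Λ A B C κ → Factorizes o Λ A B C κ) ∧
          NullOffC o Λ A B C].TFAE ∧
      ∀ {Ω : Type*} [MeasurableSpace Ω] (P : Measure Ω) [IsProbabilityMeasure P]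
        (ξ : Ω → Measure (Punctured o)), IsPoissonProcess ξ Λ P →
        (AdmitsCondIndep o L Λ A B C ↔
          CondIndepIndexed C (proj o ξ A) (proj o ξ B) (proj o ξ C) P)) ∧
    (∀ D : Finset V, D = A ∪ B ∪ C →
      ∀ (LD : ℕ → ∀ v : D, Set (E v)) (ΛD : Measure (Punctured (D.restrict o)))
        (A' B' C' : Finset D),
      LD = (fun h => D.restrict (L h)) → ΛD = marginal o Λ D →
      A' = A.subtype (· ∈ D) → B' = B.subtype (· ∈ D) → C' = C.subtype (· ∈ D) →
      [AdmitsCondIndep (D.restrict o) LD ΛD A' B' C',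
        CondIndepOnSlabs (D.restrict o) LD ΛD A' B' C' Finset.univ,
        CondIndepOnSlabs (D.restrict o) LD ΛD A' B' C' C' ∧ NullOffC (D.restrict o) ΛD A' B' C',
        (C.Nonempty → ∃ κ, IsDisintegration (D.restrict o) ΛD A' B' C' κ ∧
            Factorizes (D.restrict o) ΛD A' B' C' κ) ∧
          NullOffC (D.restrict o) ΛD A' B' C',
        (C.Nonempty → ∀ κ, IsDisintegration (D.restrict o) ΛD A' B' C' κ →
            Factorizes (D.restrict o) ΛD A' B' C' κ) ∧
          NullOffC (D.restrict o) ΛD A' B' C'].TFAE ∧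
      ∀ {Ω : Type*} [MeasurableSpace Ω] (P : Measure Ω) [IsProbabilityMeasure P]
        (ξ : Ω → Measure (Punctured o)), IsPoissonProcess ξ Λ P →
        (AdmitsCondIndep (D.restrict o) LD ΛD A' B' C' ↔
          CondIndepIndexed C (proj o ξ A) (proj o ξ B) (proj o ξ C) P)) := by
  refine ⟨fun hABC => ⟨hΛ.tfae hABC, fun P _ ξ hξ => hΛ.admitsCondIndep_iff_proj hξ hABC⟩, ?_⟩
  rintro D hD LD ΛD A' B' C' rfl rfl rfl rfl rfl
  have hAD : A ⊆ D := hD ▸ Finset.subset_union_left.trans Finset.subset_union_left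
  have hBD : B ⊆ D := hD ▸ Finset.subset_union_right.trans Finset.subset_union_left
  have hCD : C ⊆ D := hD ▸ Finset.subset_union_right
  have hABC : A.subtype (· ∈ D) ∪ B.subtype (· ∈ D) ∪ C.subtype (· ∈ D) = Finset.univ :=
    Finset.eq_univ_iff_forall.2 fun i => by
      simpa only [Finset.mem_union, Finset.mem_subtype] using
        (show i.1 ∈ A ∪ B ∪ C from hD ▸ i.2)
  have nonempty_iff : C.Nonempty ↔ (C.subtype (· ∈ D)).Nonempty :=
    ⟨fun ⟨c, hc⟩ => ⟨⟨c, hCD hc⟩, Finset.mem_subtype.2 hc⟩,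
      fun ⟨c, hc⟩ => ⟨c.1, Finset.mem_subtype.1 hc⟩⟩
  refine ⟨?_, fun P _ ξ hξ => hΛ.admitsCondIndep_marginal_iff_proj hξ hAD hBD hCD hABC⟩
  rw [nonempty_iff]
  exact (hΛ.marginal D).tfae hABC

theorem theorem4 {V : Type*} [Fintype V] [DecidableEq V] {E : V → Type*}
    [∀ v, MeasurableSpace (E v)] [∀ v, StandardBorelSpace (E v)]
    (o : ∀ v, E v) (L : ℕ → ∀ v, Set (E v)) (Λ : Measure (Punctured o))
    (hΛ : LocalizedExplosive o L Λ)
    (A B C : Finset V) (hAB : Disjoint A B) (hAC : Disjoint A C) (hBC : Disjoint B C)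
    (hA : A.Nonempty) (hB : B.Nonempty) :
    -- the case in which `A, B, C` form a partition of `V`
    (A ∪ B ∪ C = Finset.univ →
      [AdmitsCondIndep o L Λ A B C,
        CondIndepOnSlabs o L Λ A B C Finset.univ,
        CondIndepOnSlabs o L Λ A B C C ∧ NullOffC o Λ A B C,
        (C.Nonempty → ∃ κ, IsDisintegration o Λ A B C κ ∧ Factorizes o Λ A B C κ) ∧
          NullOffC o Λ A B C,
        (C.Nonempty → ∀ κ, IsDisintegration o Λ A B C κ → Factorizes o Λ A B C κ) ∧
          NullOffC o Λ A B C].TFAE ∧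
      ∀ {Ω : Type*} [MeasurableSpace Ω] (P : Measure Ω) [IsProbabilityMeasure P]
        (ξ : Ω → Measure (Punctured o)), IsPoissonProcess ξ Λ P →
        (AdmitsCondIndep o L Λ A B C ↔
          CondIndepIndexed C (proj o ξ A) (proj o ξ B) (proj o ξ C) P)) ∧
    -- the general case: the analytic statements concern the marginal measure of `Λ` over
    -- `D = A ∪ B ∪ C`, the Poisson process is still the one on the whole space
    (∀ D : Finset V, D = A ∪ B ∪ C →
      ∀ (LD : ℕ → ∀ v : D, Set (E v)) (ΛD : Measure (Punctured (D.restrict o)))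
        (A' B' C' : Finset D),
      LD = (fun h => D.restrict (L h)) → ΛD = marginal o Λ D →
      A' = A.subtype (· ∈ D) → B' = B.subtype (· ∈ D) → C' = C.subtype (· ∈ D) →
      [AdmitsCondIndep (D.restrict o) LD ΛD A' B' C',
        CondIndepOnSlabs (D.restrict o) LD ΛD A' B' C' Finset.univ,
        CondIndepOnSlabs (D.restrict o) LD ΛD A' B' C' C' ∧ NullOffC (D.restrict o) ΛD A' B' C',
        (C.Nonempty → ∃ κ, IsDisintegration (D.restrict o) ΛD A' B' C' κ ∧ Factorizes (D.restrict o) ΛD A' B' C' κ) ∧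
          NullOffC (D.restrict o) ΛD A' B' C',
        (C.Nonempty → ∀ κ, IsDisintegration (D.restrict o) ΛD A' B' C' κ → Factorizes (D.restrict o) ΛD A' B' C' κ) ∧
          NullOffC (D.restrict o) ΛD A' B' C'].TFAE ∧
      ∀ {Ω : Type*} [MeasurableSpace Ω] (P : Measure Ω) [IsProbabilityMeasure P]
        (ξ : Ω → Measure (Punctured o)), IsPoissonProcess ξ Λ P →
        (AdmitsCondIndep (D.restrict o) LD ΛD A' B' C' ↔
          CondIndepIndexed C (proj o ξ A) (proj o ξ B) (proj o ξ C) P)) :=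
  theorem4_general o L Λ hΛ A B C
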